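/- Let $n\ge 1$ and let $\Omega\subset\mathbb{R}^n$ be a bounded open set with boundary of class $C^1$. Let $T>0$, let $K\ge 1$ be an integer and $\Delta t=T/K$. Let $\phi$, $\alpha^k,\beta^k$ ($1\le k\le K$) and $\gamma^k$ ($0\le k\le K$) be real functions in $L^\infty(\Omega)$, each bounded below almost everywhere by a positive constant, and let $f^k\in L^3(\Omega)$ ($1\le k\le K$). Put $$\rho^k(S)=\gamma^k\frac{S}{\sqrt{|S|}},\qquad F^k(\mathbf w)=\frac{\sqrt{(\alpha^k)^2+4\beta^k|\mathbf w|}-\alpha^k}{2\beta^k|\mathbf w|}\,\mathbf w$$ (both being $0$ where $S=0$, respectively $\mathbf w=0$). Let $W^3(\mathrm{div};\Omega)=\{\mathbf v\in L^3(\Omega)^n:\ \mathrm{div}\,\mathbf v\in L^3(\Omega)\}$ with the distributional divergence, and let $W^{1,3/2}_0(\Omega)$ be the kernel of the trace operator $\gamma_0$ on $W^{1,3/2}(\Omega)$. Fix $k\in\{1,\dots,K\}$ and $S^{k-1}\in L^{3/2}(\Omega)$, and consider two problems. Mixed formulation: find $(\mathbf m^k,S^k)\in W^3(\mathrm{div};\Omega)\times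 L^{3/2}(\Omega)$ such that $$\int_\Omega(\alpha^k+\beta^k|\mathbf m^k|)\,\mathbf m^k\cdot\mathbf v\,dx-\int_\Omega \mathrm{div}(\mathbf v)\,S^k\,dx=0\quad\text{for all }\mathbf v\in W^3(\mathrm{div};\Omega),$$ $$\int_\Omega\frac{\phi}{\Delta t}\bigl(\rho^k(S^k)-\rho^{k-1}(S^{k-1})\bigr)q\,dx+\int_\Omega\mathrm{div}(\mathbf m^k)\,q\,dx=\int_\Omega f^kq\,dx\quad\text{for all }q\in L^{3/2}(\Omega).$$ Primal formulation: find $S^k\in W^{1,3/2}_0(\Omega)$ such that $$\int_\Omega\frac{\phi}{\Delta t}\bigl(\rho^k(S^k)-\rho^{k-1}(S^{k-1})\bigr)q\,dx+\int_\Omega F^k(\nabla S^k)\cdot\nabla q\,dx=\int_\Omega f^kq\,dx\quad\text{for all }q\in W^{1,3/2}_0(\Omega).$$ Then: (a) If $S^k$ solves the primal formulation, then $(-F^k(\nabla S^k),S^k)$ solves the mixed formulation. In particular $F^k(\nabla S^k)\in W^3(\mathrm{div};\Omega)$. (b) If $(\mathbf m^k,S^k)$ solves the mixed formulation, then $S^k$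 solves the primal formulation and $\mathbf m^k=-F^k(\nabla S^k)$ almost everywhere in $\Omega$. In particular $S^k\in W^{1,3/2}_0(\Omega)$, that is, $\gamma_0S^k=0$. -/

import Mathlib

open MeasureTheory Set Filter Topology
open scoped ENNReal ContDiff

noncomputable section

namespace DarcyForchheimer

/-- The Euclidean space `ℝⁿ`. -/
abbrev E (n : ℕ) : Type := EuclideanSpace ℝ (Fin n)

variable {n : ℕ}

/-- Lebesgue measure on `Ω`. A function on `Ω` is represented by a function on `ℝⁿ`, of which only
the values almost everywhere in `Ω` matter. -/
abbrev vol (Ω : Set (E n)) : Measure (E n) := volume.restrict Ω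

/-- The surface measure of the boundary of `Ω`: the `(n-1)`-dimensional Hausdorff measure. -/
def surf (Ω : Set (E n)) : Measure (E n) :=
  (Measure.hausdorffMeasure ((n : ℝ) - 1)).restrict (frontier Ω)

/-- `Ω` has a boundary of class `C¹`: near each boundary point there are a unit vector `e` and a
`C¹` function `h` of the component of `x` orthogonal to `e` such that `Ω` is locally the set of
points whose `e`-coordinate lies above the graph of `h`. -/
def HasC1Boundary (Ω : Set (E n)) : Prop :=
  ∀ x₀ ∈ frontier Ω, ∃ (r : ℝ) (e : E n) (h : E n → ℝ), 0 < r ∧ ‖e‖ = 1 ∧ ContDiff ℝ 1 h ∧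
    ∀ x ∈ Metric.ball x₀ r, (x ∈ Ω ↔ h (x - inner ℝ e x • e) < inner ℝ e x)

/-- Test functions `𝒟(Ω)`: smooth functions with compact support inside `Ω`. -/
def IsTest (Ω : Set (E n)) (ψ : E n → ℝ) : Prop :=
  ContDiff ℝ ∞ ψ ∧ HasCompactSupport ψ ∧ tsupport ψ ⊆ Ω

/-- `g` is the generalized (distributional) gradient of `u` on `Ω`. -/
def IsWeakGrad (Ω : Set (E n)) (u : E n → ℝ) (g : E n → E n) : Prop :=
  LocallyIntegrableOn u Ω volume ∧ LocallyIntegrableOn g Ω volume ∧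
    ∀ ψ, IsTest Ω ψ → ∀ w : E n,
      ∫ x in Ω, u x * fderiv ℝ ψ x w = - ∫ x in Ω, inner ℝ (g x) w * ψ x

/-- `d` is the generalized (distributional) divergence of the vector field `v` on `Ω`. -/
def IsWeakDiv (Ω : Set (E n)) (v : E n → E n) (d : E n → ℝ) : Prop :=
  LocallyIntegrableOn v Ω volume ∧ LocallyIntegrableOn d Ω volume ∧
    ∀ ψ, IsTest Ω ψ →
      ∫ x in Ω, inner ℝ (v x) (gradient ψ x) = - ∫ x in Ω, d x * ψ x

open Classical in
/-- The generalized gradient `∇u` on `Ω` (unique up to null sets; `0` if there is none). -/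
def weakGrad (Ω : Set (E n)) (u : E n → ℝ) : E n → E n :=
  if h : ∃ g, IsWeakGrad Ω u g then h.choose else 0

open Classical in
/-- The generalized divergence `div v` on `Ω` (unique up to null sets; `0` if there is none). -/
def weakDiv (Ω : Set (E n)) (v : E n → E n) : E n → ℝ :=
  if h : ∃ d, IsWeakDiv Ω v d then h.choose else 0

theorem weakGrad_spec {Ω : Set (E n)} {u : E n → ℝ} {g : E n → E n} (h : IsWeakGrad Ω u g) :
    IsWeakGrad Ω u (weakGrad Ω u) := by
  have h' : ∃ g, IsWeakGrad Ω u g := ⟨g, h⟩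
  rw [weakGrad, dif_pos h']
  exact h'.choose_spec

theorem weakDiv_spec {Ω : Set (E n)} {v : E n → E n} {d : E n → ℝ} (h : IsWeakDiv Ω v d) :
    IsWeakDiv Ω v (weakDiv Ω v) := by
  have h' : ∃ d, IsWeakDiv Ω v d := ⟨d, h⟩
  rw [weakDiv, dif_pos h']
  exact h'.choose_spec

/-- The Sobolev space `W^{1,s}(Ω)`. -/
def MemW1 (Ω : Set (E n)) (s : ℝ≥0∞) (u : E n → ℝ) : Prop :=
  MemLp u s (vol Ω) ∧ ∃ g, IsWeakGrad Ω u g ∧ MemLp g s (vol Ω)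

/-- The space `W^s(div; Ω)` of the fields in `L^s(Ω)ⁿ` with divergence in `L^s(Ω)`. -/
def MemWdiv (Ω : Set (E n)) (s : ℝ≥0∞) (v : E n → E n) : Prop :=
  MemLp v s (vol Ω) ∧ ∃ d, IsWeakDiv Ω v d ∧ MemLp d s (vol Ω)

/-- `θ` is the trace `γ₀ u` on `∂Ω` of `u ∈ W^{1,s}(Ω)`. The trace operator is the continuous
extension to `W^{1,s}(Ω)` of the restriction `Ψ ↦ Ψ|_∂Ω`, defined on the dense subspace of the
functions `Ψ|_Ω` with `Ψ` smooth and compactly supported in `ℝⁿ`. -/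
def HasTrace (Ω : Set (E n)) (s : ℝ≥0∞) (u θ : E n → ℝ) : Prop :=
  MemW1 Ω s u ∧ MemLp θ s (surf Ω) ∧
    ∃ Ψ : ℕ → E n → ℝ, (∀ j, ContDiff ℝ ∞ (Ψ j) ∧ HasCompactSupport (Ψ j)) ∧
      Tendsto (fun j => eLpNorm (Ψ j - u) s (vol Ω)) atTop (𝓝 0) ∧
      Tendsto (fun j => eLpNorm (gradient (Ψ j) - weakGrad Ω u) s (vol Ω)) atTop (𝓝 0) ∧
      Tendsto (fun j => eLpNorm (Ψ j - θ) s (surf Ω)) atTop (𝓝 0)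

/-- `W^{1,s}_0(Ω)`, the kernel of the trace operator. -/
def MemW10 (Ω : Set (E n)) (s : ℝ≥0∞) (u : E n → ℝ) : Prop :=
  HasTrace Ω s u 0

/-- A coefficient in `L^∞(Ω)` that is bounded below by a positive constant. -/
def IsCoeff (Ω : Set (E n)) (a : E n → ℝ) : Prop :=
  AEStronglyMeasurable a (vol Ω) ∧
    ∃ l u : ℝ, 0 < l ∧ ∀ᵐ x ∂(vol Ω), l ≤ a x ∧ a x ≤ u

/-- The equation of state `ρ(S) = γ S / √|S|` (equal to `0` where `S = 0`). -/
def rho (γ S : E n → ℝ) : E n → ℝ :=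
  fun x => γ x * (S x / √|S x|)

/-- The mapping `F(w) = (√(α² + 4 β |w|) - α) / (2 β |w|) w` (equal to `0` where `w = 0`). -/
def F (α β : E n → ℝ) (w : E n → E n) : E n → E n :=
  fun x => ((√(α x ^ 2 + 4 * β x * ‖w x‖) - α x) / (2 * β x * ‖w x‖)) • w x

/-- `(m, S) ∈ W³(div; Ω) × L^{3/2}(Ω)` solves the mixed formulation of one time step with
homogeneous Dirichlet data: step size `Δt`, coefficients `φ, α, β, γ`, source `f`, and `γ', S'`
the values of `γ` and `S` at the preceding time level. -/
def IsMixedSolution (Ω : Set (E n)) (Δt : ℝ) (φ α β γ γ' f S' : E n → ℝ)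
    (m : E n → E n) (S : E n → ℝ) : Prop :=
  MemWdiv Ω 3 m ∧ MemLp S (3 / 2) (vol Ω) ∧
    (∀ v, MemWdiv Ω 3 v →
      (∫ x in Ω, (α x + β x * ‖m x‖) * inner ℝ (m x) (v x))
        - ∫ x in Ω, weakDiv Ω v x * S x = 0) ∧
    (∀ q, MemLp q (3 / 2) (vol Ω) →
      (∫ x in Ω, φ x / Δt * (rho γ S x - rho γ' S' x) * q x)
        + ∫ x in Ω, weakDiv Ω m x * q x = ∫ x in Ω, f x * q x)

/-- `S ∈ W^{1,3/2}_0(Ω)` solves the primal variational formulation of the same time step. -/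
def IsPrimalSolution (Ω : Set (E n)) (Δt : ℝ) (φ α β γ γ' f S' : E n → ℝ)
    (S : E n → ℝ) : Prop :=
  MemW10 Ω (3 / 2) S ∧
    ∀ q, MemW10 Ω (3 / 2) q →
      (∫ x in Ω, φ x / Δt * (rho γ S x - rho γ' S' x) * q x)
        + ∫ x in Ω, inner ℝ (F α β (weakGrad Ω S) x) (weakGrad Ω q x) = ∫ x in Ω, f x * q x

end DarcyForchheimer

end

open DarcyForchheimer

/-! For almost every `x`, `F` is the inverse of the Forchheimer law `p ↦ (α + β|p|) p`
(`forchheimer_inv`, `forchheimer_apply`), so `m = -F(∇S)` means `∇S = -(α + β|m|) m`. Quadratic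
growth makes these maps exchange `L^{3/2}` and `L³`, which are dual exponents.

The analytic core is that, on a bounded `C¹` domain, three properties of `u` agree: its trace
vanishes, its extension by zero is weakly differentiable on `ℝⁿ` (`HasZeroExtGrad`), and it is a
`W^{1,s}` limit of test functions. The first gives the second by a boundary estimate in graph
coordinates (`HasTrace.hasZeroExtGrad`). The second gives the third by a partition of unity and
mollification with kernels shifted into the domain (`HasZeroExtGrad.exists_isTest_near`). The third
gives the first because test functions vanish on the boundary (`HasZeroExtGrad.memW10`). Green's
formula between `W³(div)` and `W₀^{1,3/2}` follows by density.

For (a), test functions in the primal equation identify `div F(∇S)` as an `L³` function, which is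
the mass equation; Green's formula is the flux equation. For (b), the flux equation tested with `ζ
w`, where `ζ` is smooth and compactly supported in `ℝⁿ` but not necessarily in `Ω`, says exactly
that `S` extended by zero has gradient `-(α + β|m|) m` extended by zero. Hence `S` has zero trace,
inverting the law gives `m = -F(∇S)`, and Green's formula turns the mass equation into the primal
one. -/

/-! ### Translations and mollification in `L^p`. -/

theorem exists_eLpNorm_translate_sub_le {n : ℕ} {V : Type*} [NormedAddCommGroup V]
    {p : ℝ≥0∞} (hp1 : 1 ≤ p) (hp : p ≠ ⊤) {f : E n → V} (hf : MemLp f p volume)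
    {ε : ℝ≥0∞} (hε : ε ≠ 0) :
    ∃ η > 0, ∀ y : E n, ‖y‖ < η → eLpNorm (fun x => f (x - y) - f x) p volume ≤ ε := by
  have : Fact (1 ≤ p) := ⟨hp1⟩
  -- Currying makes `y ↦ (x ↦ x - y)` continuous into the compact-open topology, along which
  -- composition with measure-preserving maps is continuous in `L^p`.
  let g : C(E n, C(E n, E n)) :=
    (ContinuousMap.mk (fun a : E n × E n => a.2 - a.1) (by fun_prop)).curry
  have hgm : ∀ y, MeasurePreserving (g y) (volume : Measure (E n)) volume := fun y =>
    measurePreserving_sub_right (volume : Measure (E n)) y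
  have h1 : Tendsto (fun y => Lp.compMeasurePreserving (g y) (hgm y) hf.toLp) (𝓝 0)
      (𝓝 (Lp.compMeasurePreserving (g 0) (hgm 0) hf.toLp)) :=
    Filter.Tendsto.compMeasurePreservingLp tendsto_const_nhds (g.continuous.tendsto 0) hgm
      (hgm 0) hp
  have h2 := (EMetric.tendsto_nhds.1 h1) ε (pos_iff_ne_zero.2 hε)
  obtain ⟨η, hη, h3⟩ := Metric.eventually_nhds_iff.1 h2
  refine ⟨η, hη, fun y hy => ?_⟩
  have h4 := (h3 (y := y) (by simpa using hy)).le
  rw [Lp.edist_def] at h4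
  refine le_trans (le_of_eq (eLpNorm_congr_ae ?_)) h4
  have h5 : ∀ z, (Lp.compMeasurePreserving (g z) (hgm z) hf.toLp : E n → V)
      =ᵐ[volume] fun x => f (x - z) := fun z => by
    refine (Lp.coeFn_compMeasurePreserving _ (hgm z)).trans ?_
    have := (hgm z).quasiMeasurePreserving.ae_eq_comp hf.coeFn_toLp
    simpa [g, Function.comp_def] using this
  filter_upwards [h5 y, h5 0] with x hx hx0
  rw [Pi.sub_apply, hx, hx0, sub_zero]

/-- Averages of `f` over translations by small vectors are close to `f` in `L^p`. -/
theorem exists_eLpNorm_convolution_sub_le {n : ℕ} {V : Type*} [NormedAddCommGroup V]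
    [NormedSpace ℝ V] [CompleteSpace V]
    {p : ℝ≥0∞} (hp1 : 1 ≤ p) (hp : p ≠ ⊤) {f : E n → V} (hf : MemLp f p volume)
    {ε : ℝ≥0∞} (hε : ε ≠ 0) :
    ∃ η > 0, ∀ κ : E n → ℝ, Continuous κ → (∀ x, 0 ≤ κ x) → HasCompactSupport κ →
      ∫ x, κ x = 1 → Function.support κ ⊆ Metric.ball 0 η →
      eLpNorm (fun x => (∫ y, κ y • f (x - y)) - f x) p volume ≤ ε := by
  obtain ⟨η, hη, h⟩ := exists_eLpNorm_translate_sub_le hp1 hp hf hε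
  refine ⟨η, hη, fun κ hκ hκ0 hκc hκ1 hκs => ?_⟩
  have hp0 : p ≠ 0 := (one_pos.trans_le hp1).ne'
  have hpr : 0 < p.toReal := ENNReal.toReal_pos hp0 hp
  have hκi : Integrable κ := hκ.integrable_of_hasCompactSupport hκc
  -- Seen as an expectation under `κ dx`, the average obeys Jensen's inequality, here as
  -- monotonicity of `L^p` norms on a probability space; Tonelli then reduces the claim to single
  -- translations.
  let μ : Measure (E n) := volume.withDensity (fun x => ENNReal.ofReal (κ x))
  have : IsProbabilityMeasure μ := ⟨by
    simp only [μ, withDensity_apply _ MeasurableSet.univ, Measure.restrict_univ]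
    rw [← ofReal_integral_eq_lintegral_ofReal hκi (Eventually.of_forall hκ0), hκ1]
    simp⟩
  have hac : μ ≪ volume := withDensity_absolutelyContinuous _ _
  have hmeas : AEStronglyMeasurable (fun z : E n × E n => f (z.1 - z.2) - f z.1)
      (volume.prod μ) := by
    refine AEStronglyMeasurable.sub ?_ ?_
    · have := (hf.1.comp_quasiMeasurePreserving
        (quasiMeasurePreserving_sub_of_right_invariant volume volume))
      exact this.mono_ac (Measure.AbsolutelyContinuous.rfl.prod hac)
    · exact hf.1.comp_fst
  have hint : ∀ (g : E n → V), ∫ y, g y ∂μ = ∫ y, κ y • g y := fun g => by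
    simp only [μ]
    rw [integral_withDensity_eq_integral_toReal_smul (by fun_prop) (by simp)]
    simp [ENNReal.toReal_ofReal (hκ0 _)]
  have hloc := hf.locallyIntegrable hp1
  have hpt : ∀ x, (∫ y, κ y • f (x - y)) - f x = ∫ y, (f (x - y) - f x) ∂μ := fun x => by
    have hi : Integrable (fun y => κ y • f (x - y)) := by
      have := hκc.convolutionExists_left (ContinuousLinearMap.lsmul ℝ ℝ) hκ hloc x
      simpa [ConvolutionExistsAt] using this
    rw [hint]
    simp only [smul_sub]
    rw [integral_sub hi (hκi.smul_const _), integral_smul_const, hκ1, one_smul]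
  simp_rw [hpt]
  rw [eLpNorm_eq_lintegral_rpow_enorm_toReal hp0 hp, one_div, ENNReal.rpow_inv_le_iff hpr]
  have hsec : ∀ᵐ x ∂(volume : Measure (E n)),
      AEStronglyMeasurable (fun y => f (x - y) - f x) μ := hmeas.prodMk_left
  calc ∫⁻ x, ‖∫ y, (f (x - y) - f x) ∂μ‖ₑ ^ p.toReal
      ≤ ∫⁻ x, ∫⁻ y, ‖f (x - y) - f x‖ₑ ^ p.toReal ∂μ := by
        refine lintegral_mono_ae ?_
        filter_upwards [hsec] with x hx
        have h1 : ‖∫ y, (f (x - y) - f x) ∂μ‖ₑ ≤ eLpNorm (fun y => f (x - y) - f x) 1 μ := by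
          rw [eLpNorm_one_eq_lintegral_enorm]
          exact enorm_integral_le_lintegral_enorm _
        have h2 := h1.trans (eLpNorm_le_eLpNorm_of_exponent_le hp1 hx)
        rw [eLpNorm_eq_lintegral_rpow_enorm_toReal hp0 hp, one_div,
          ENNReal.le_rpow_inv_iff hpr] at h2
        exact h2
    _ = ∫⁻ y, (∫⁻ x, ‖f (x - y) - f x‖ₑ ^ p.toReal) ∂μ := by
        rw [lintegral_lintegral_swap]
        exact hmeas.enorm.pow_const _
    _ ≤ ∫⁻ y, ε ^ p.toReal ∂μ := by
        refine lintegral_mono_ae ?_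
        have : ∀ᵐ y ∂μ, y ∈ Metric.ball (0 : E n) η := by
          rw [ae_withDensity_iff (by fun_prop)]
          refine Eventually.of_forall fun y hy => hκs ?_
          intro h0
          simp [h0] at hy
        filter_upwards [this] with y hy
        have h2 := h y (by simpa using hy)
        rw [eLpNorm_eq_lintegral_rpow_enorm_toReal hp0 hp, one_div,
          ENNReal.rpow_inv_le_iff hpr] at h2
        exact h2
    _ = ε ^ p.toReal := by simp

/-! ### Partitions of unity and calculus of smooth functions. -/

/-- A finite smooth partition of unity near a compact set. -/
theorem exists_finite_partition {n : ℕ} {K : Set (E n)} (hK : IsCompact K) (U : E n → Set (E n))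
    (hU : ∀ x, IsOpen (U x)) (hxU : ∀ x, x ∈ U x) :
    ∃ (t : Finset (E n)) (χ : t → E n → ℝ),
      (∀ i, ContDiff ℝ ∞ (χ i) ∧ HasCompactSupport (χ i) ∧ tsupport (χ i) ⊆ U i) ∧
      ∀ x ∈ K, ∑ i, χ i x = 1 := by
  -- Intersecting with unit balls forces the partition functions to have compact support.
  obtain ⟨t, ht⟩ := hK.elim_finite_subcover (fun x => U x ∩ Metric.ball x 1)
    (fun x => (hU x).inter Metric.isOpen_ball)
    (fun x _ => mem_iUnion.2 ⟨x, hxU x, Metric.mem_ball_self one_pos⟩)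
  obtain ⟨f, hf⟩ := SmoothPartitionOfUnity.exists_isSubordinate (modelWithCornersSelf ℝ (E n))
    hK.isClosed (fun i : t => U i ∩ Metric.ball (i : E n) 1)
    (fun x => (hU x).inter Metric.isOpen_ball) (by simpa [iUnion_subtype] using ht)
  refine ⟨t, fun i => f i, fun i => ⟨(f i).contMDiff.contDiff, ?_, (hf i).trans inter_subset_left⟩,
    fun x hx => ?_⟩
  · refine HasCompactSupport.of_support_subset_isCompact (isCompact_closedBall (i : E n) 1) ?_
    exact (subset_tsupport _).trans ((hf i).trans
      (inter_subset_right.trans Metric.ball_subset_closedBall))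
  · have := f.sum_eq_one hx
    rwa [finsum_eq_sum_of_fintype] at this

theorem continuous_gradient {n : ℕ} {ζ : E n → ℝ} (h : ContDiff ℝ ∞ ζ) :
    Continuous (gradient ζ) :=
  (InnerProductSpace.toDual ℝ (E n)).symm.continuous.comp (h.continuous_fderiv (by simp))

theorem hasCompactSupport_gradient {n : ℕ} {ζ : E n → ℝ} (h : HasCompactSupport ζ) :
    HasCompactSupport (gradient ζ) :=
  (h.fderiv ℝ).comp_left (g := (InnerProductSpace.toDual ℝ (E n)).symm) (map_zero _)

theorem gradient_finset_sum {n : ℕ} {ι : Type*} (t : Finset ι) {ζ : ι → E n → ℝ}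
    (h : ∀ i, ContDiff ℝ ∞ (ζ i)) (x : E n) :
    gradient (fun y => ∑ i ∈ t, ζ i y) x = ∑ i ∈ t, gradient (ζ i) x := by
  simp only [gradient]
  rw [fderiv_fun_sum fun i _ => ((h i).differentiable (by simp)).differentiableAt, map_sum]

theorem fderiv_mul_smooth_apply {n : ℕ} {ζ χ : E n → ℝ} (h : ContDiff ℝ ∞ ζ)
    (h' : ContDiff ℝ ∞ χ) (x w : E n) :
    fderiv ℝ (fun y => ζ y * χ y) x w = ζ x * fderiv ℝ χ x w + χ x * fderiv ℝ ζ x w := by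
  rw [fderiv_fun_mul (h.differentiable (by simp)).differentiableAt
    (h'.differentiable (by simp)).differentiableAt]
  simp

/-! ### Approximation by test functions when the zero extension is weakly differentiable. -/

/-- The extension of `u` by zero outside `Ω` has the extension of `g` by zero as its
distributional gradient on `ℝⁿ`. -/
def HasZeroExtGrad {n : ℕ} (Ω : Set (E n)) (u : E n → ℝ) (g : E n → E n) : Prop :=
  ∀ ζ : E n → ℝ, ContDiff ℝ ∞ ζ → HasCompactSupport ζ → ∀ w : E n,
    ∫ x in Ω, u x * fderiv ℝ ζ x w = - ∫ x in Ω, inner ℝ (g x) w * ζ x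

/-- Near each point, a domain with `C¹` boundary can be pushed into itself along a fixed
direction. -/
theorem exists_push_inside {n : ℕ} {Ω : Set (E n)} (hΩo : IsOpen Ω) (hΩ : HasC1Boundary Ω)
    (x₀ : E n) : ∃ (U : Set (E n)) (e : E n), IsOpen U ∧ x₀ ∈ U ∧
      ∀ K ⊆ U, IsCompact K → ∀ᶠ τ : ℝ in 𝓝[>] 0, ∀ y ∈ K ∩ closure Ω, y + τ • e ∈ Ω := by
  by_cases h1 : x₀ ∈ Ω
  · refine ⟨Ω, 0, hΩo, h1, fun K hK _ => Eventually.of_forall fun τ y hy => ?_⟩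
    simpa using hK hy.1
  by_cases h2 : x₀ ∈ closure Ω
  swap
  · refine ⟨(closure Ω)ᶜ, 0, isClosed_closure.isOpen_compl, h2,
      fun K hK _ => Eventually.of_forall fun τ y hy => absurd hy.2 (hK hy.1)⟩
  have h3 : x₀ ∈ frontier Ω := ⟨h2, fun h => h1 (interior_subset h)⟩
  obtain ⟨r, e, h, hr, he, hh, hΩr⟩ := hΩ x₀ h3
  refine ⟨Metric.ball x₀ r, e, Metric.isOpen_ball, Metric.mem_ball_self hr, fun K hK hKc => ?_⟩
  obtain ⟨δ, hδ, hKδ⟩ := hKc.exists_thickening_subset_open Metric.isOpen_ball hK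
  have h4 : ∀ᶠ τ : ℝ in 𝓝[>] 0, τ < δ := nhdsWithin_le_nhds (Iio_mem_nhds hδ)
  filter_upwards [h4, self_mem_nhdsWithin] with τ hτ hτ0 y hy
  have hτ0 : 0 < τ := hτ0
  have hball : y + τ • e ∈ Metric.ball x₀ r := by
    refine hKδ (Metric.mem_thickening_iff.2 ⟨y, hy.1, ?_⟩)
    simp [dist_eq_norm, norm_smul, he, abs_of_pos hτ0, hτ]
  rw [hΩr _ hball]
  have he2 : inner ℝ e e = (1 : ℝ) := by rw [real_inner_self_eq_norm_sq, he]; norm_num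
  have h5 : inner ℝ e (y + τ • e) = inner ℝ e y + τ := by
    rw [inner_add_right, inner_smul_right, he2, mul_one]
  have h6 : y + τ • e - (inner ℝ e y + τ) • e = y - inner ℝ e y • e := by module
  rw [h5, h6]
  -- On the closure only the non-strict graph inequality survives; the shift raises the
  -- `e`-coordinate by `τ > 0` and keeps the orthogonal part, so it becomes strict.
  have h7 : h (y - inner ℝ e y • e) ≤ inner ℝ e y := by
    have h8 : y ∈ closure (Ω ∩ Metric.ball x₀ r) := by
      have := Metric.isOpen_ball.inter_closure (s := Metric.ball x₀ r) (t := Ω) ⟨hK hy.1, hy.2⟩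
      rwa [inter_comm] at this
    have h9 : IsClosed {z : E n | h (z - inner ℝ e z • e) ≤ inner ℝ e z} :=
      isClosed_le (hh.continuous.comp (by fun_prop)) (by fun_prop)
    exact h9.closure_subset_iff.2 (fun z hz => ((hΩr z hz.2).1 hz.1).le) h8
  linarith

/-- The mollifier is centred at `τ e` instead of `0`: convolution then moves the support `K` into
`Ω` before smearing it by `δ`. Shift and radius are both at most `η / 2`, so the kernel lives in the
`η`-ball where averages are `L^p`-close. The gradient falls on `G` because `G` is the distributional
gradient of `v` on all of `ℝⁿ`. -/
theorem exists_isTest_near_of_push {n : ℕ} {Ω : Set (E n)} (hΩo : IsOpen Ω) {p : ℝ≥0∞}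
    (hp1 : 1 ≤ p) (hp : p ≠ ⊤) {K : Set (E n)} (hK : IsCompact K) {e : E n}
    (hpush : ∀ᶠ τ : ℝ in 𝓝[>] 0, ∀ y ∈ K, y + τ • e ∈ Ω)
    {v : E n → ℝ} {G : E n → E n} (hv : MemLp v p volume) (hG : MemLp G p volume)
    (hvK : ∀ x, x ∉ K → v x = 0) (hvG : HasZeroExtGrad univ v G) {ε : ℝ≥0∞} (hε : ε ≠ 0) :
    ∃ Ψ, IsTest Ω Ψ ∧ eLpNorm (Ψ - v) p volume ≤ ε ∧ eLpNorm (gradient Ψ - G) p volume ≤ ε := by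
  obtain ⟨η₁, hη₁, h₁⟩ := exists_eLpNorm_convolution_sub_le hp1 hp hv hε
  obtain ⟨η₂, hη₂, h₂⟩ := exists_eLpNorm_convolution_sub_le hp1 hp hG hε
  set η := min η₁ η₂
  have hη : 0 < η := lt_min hη₁ hη₂
  have hτ1 : ∀ᶠ τ : ℝ in 𝓝[>] 0, ‖τ • e‖ < η / 2 := by
    refine nhdsWithin_le_nhds ?_
    have : Tendsto (fun τ : ℝ => ‖τ • e‖) (𝓝 0) (𝓝 ‖(0 : ℝ) • e‖) :=
      (by fun_prop : Continuous fun τ : ℝ => ‖τ • e‖).tendsto 0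
    exact this.eventually (Iio_mem_nhds (by simpa using half_pos hη))
  obtain ⟨τ, hτη, hτK⟩ := (hτ1.and hpush).exists
  have hK' : IsCompact ((fun y => y + τ • e) '' K) := hK.image (by fun_prop)
  obtain ⟨δ₀, hδ₀, hKδ⟩ := hK'.exists_cthickening_subset_open hΩo
    (by rintro _ ⟨y, hy, rfl⟩; exact hτK y hy)
  set δ := min δ₀ (η / 2)
  have hδ : 0 < δ := lt_min hδ₀ (half_pos hη)
  let b : ContDiffBump (τ • e) := ⟨δ / 2, δ, half_pos hδ, half_lt_self hδ⟩
  let κ : E n → ℝ := b.normed volume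
  have hκs : Function.support κ = Metric.ball (τ • e) δ := b.support_normed_eq
  have hκc : HasCompactSupport κ := b.hasCompactSupport_normed
  have hκd : ContDiff ℝ ∞ κ := b.contDiff_normed
  have hκη : Function.support κ ⊆ Metric.ball 0 η := by
    rw [hκs]
    refine Metric.ball_subset_ball' ?_
    rw [dist_zero_right]
    linarith [min_le_right δ₀ (η / 2)]
  have hvl := hv.locallyIntegrable hp1
  have hGl := hG.locallyIntegrable hp1
  let Ψ : E n → ℝ := fun x => ∫ y, κ y • v (x - y)
  have hΨ : Ψ = convolution v κ (ContinuousLinearMap.mul ℝ ℝ) volume := by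
    ext x
    rw [convolution_mul_swap]
    simp only [Ψ, smul_eq_mul]
    simp_rw [mul_comm]
  have hΨd : ContDiff ℝ ∞ Ψ := by
    rw [hΨ]; exact hκc.contDiff_convolution_right _ hvl hκd
  have hΨs : Function.support Ψ ⊆ Metric.cthickening δ ((fun y => y + τ • e) '' K) := by
    intro x hx
    by_contra hcon
    refine hx (integral_eq_zero_of_ae (Eventually.of_forall fun y => ?_))
    by_contra h0
    have hy0 : κ y ≠ 0 := fun h => h0 (by simp [h])
    have hv0 : v (x - y) ≠ 0 := fun h => h0 (by simp [h])
    have hyK : x - y ∈ K := by by_contra hh; exact hv0 (hvK _ hh)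
    have hyb : y ∈ Metric.ball (τ • e) δ := hκs ▸ (Function.mem_support.2 hy0)
    refine hcon (Metric.thickening_subset_cthickening _ _
      (Metric.mem_thickening_iff.2 ⟨x - y + τ • e, ⟨_, hyK, rfl⟩, ?_⟩))
    rw [Metric.mem_ball, dist_eq_norm] at hyb
    rw [dist_eq_norm]
    convert hyb using 2
    abel
  have hΨt : tsupport Ψ ⊆ Metric.cthickening δ ((fun y => y + τ • e) '' K) :=
    closure_minimal hΨs Metric.isClosed_cthickening
  have hΨgrad : ∀ x, gradient Ψ x = ∫ y, κ y • G (x - y) := by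
    intro x
    refine ext_inner_right ℝ fun w => ?_
    rw [inner_gradient_left]
    have hi : Integrable (fun y => κ y • G (x - y)) := by
      have := hκc.convolutionExists_left (ContinuousLinearMap.lsmul ℝ ℝ) hκd.continuous hGl x
      simpa [ConvolutionExistsAt] using this
    have hd := hκc.hasFDerivAt_convolution_right (ContinuousLinearMap.mul ℝ ℝ) hvl
      (hκd.of_le (by exact_mod_cast le_top)) x
    rw [← hΨ] at hd
    rw [hd.fderiv, convolution_precompR_apply _ hvl (hκc.fderiv ℝ)
      (hκd.continuous_fderiv (by simp)), convolution_mul]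
    -- The reflected kernel is the test function to insert in the weak gradient identity for `v`.
    let ζ : E n → ℝ := fun t => κ (x - t)
    have hζd : ContDiff ℝ ∞ ζ := hκd.comp (contDiff_const.sub contDiff_id)
    have hζc : HasCompactSupport ζ := hκc.comp_homeomorph (Homeomorph.subLeft x)
    have hζw : ∀ t, fderiv ℝ κ (x - t) w = - fderiv ℝ ζ t w := fun t => by
      have h1 : HasFDerivAt (fun t => x - t) (-ContinuousLinearMap.id ℝ (E n)) t := by
        simpa using (hasFDerivAt_id t).const_sub x
      have h2 := ((hκd.differentiable (by simp)) (x - t)).hasFDerivAt.comp t h1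
      have h3 : HasFDerivAt ζ _ t := h2
      rw [h3.fderiv]
      simp
    have h4 := hvG ζ hζd hζc w
    simp only [Measure.restrict_univ] at h4
    simp_rw [hζw, mul_neg]
    rw [integral_neg, h4, neg_neg, ← integral_sub_left_eq_self _ volume x]
    rw [real_inner_comm, ← integral_inner hi w]
    refine integral_congr_ae (Eventually.of_forall fun y => ?_)
    simp [ζ, inner_smul_right, real_inner_comm, mul_comm]
  refine ⟨Ψ, ⟨hΨd, ?_, ?_⟩, ?_, ?_⟩
  · exact HasCompactSupport.of_support_subset_isCompact hK'.cthickening hΨs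
  · exact hΨt.trans ((Metric.cthickening_mono (min_le_left _ _) _).trans hKδ)
  · exact h₁ κ hκd.continuous (fun x => b.nonneg_normed x) hκc b.integral_normed
      (hκη.trans (Metric.ball_subset_ball (min_le_left _ _)))
  · have : gradient Ψ - G = fun x => (∫ y, κ y • G (x - y)) - G x := by
      ext1 x; simp [hΨgrad]
    rw [this]
    exact h₂ κ hκd.continuous (fun x => b.nonneg_normed x) hκc b.integral_normed
      (hκη.trans (Metric.ball_subset_ball (min_le_right _ _)))

theorem MeasureTheory.MemLp.integrable_smul_of_hasCompactSupport {n : ℕ} {V : Type*}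
    [NormedAddCommGroup V] [NormedSpace ℝ V]
    {Ω : Set (E n)} {p : ℝ≥0∞} (hp1 : 1 ≤ p) {u : E n → V} (hu : MemLp u p (vol Ω))
    {ζ : E n → ℝ} (hζ : Continuous ζ) (hζc : HasCompactSupport ζ) :
    Integrable (fun x => ζ x • u x) (vol Ω) :=
  (hu.locallyIntegrable hp1).integrable_smul_left_of_hasCompactSupport hζ hζc

/-- The product rule, obtained by testing with `χ ζ`. No boundary condition on `χ` is needed, since
the identity for `u` already admits test functions that cross the boundary. -/
theorem HasZeroExtGrad.mul_smooth {n : ℕ} {Ω : Set (E n)} (hΩo : IsOpen Ω)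
    {p : ℝ≥0∞} (hp1 : 1 ≤ p)
    {u : E n → ℝ} {g : E n → E n} (hu : MemLp u p (vol Ω)) (hg : MemLp g p (vol Ω))
    (h : HasZeroExtGrad Ω u g) {χ : E n → ℝ} (hχ : ContDiff ℝ ∞ χ) :
    HasZeroExtGrad univ (Ω.indicator fun x => χ x * u x)
      (Ω.indicator fun x => χ x • g x + u x • gradient χ x) := by
  intro ζ hζ hζc w
  have h1 := h (fun x => χ x * ζ x) (hχ.mul hζ) (hζc.mul_left) w
  have hL : ∀ x, Ω.indicator (fun x => χ x * u x) x * fderiv ℝ ζ x w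
      = Ω.indicator (fun x => χ x * u x * fderiv ℝ ζ x w) x := fun x => by
    by_cases hx : x ∈ Ω <;> simp [hx]
  have hR : ∀ x, inner ℝ (Ω.indicator (fun x => χ x • g x + u x • gradient χ x) x) w * ζ x
      = Ω.indicator (fun x => inner ℝ (χ x • g x + u x • gradient χ x) w * ζ x) x := fun x => by
    by_cases hx : x ∈ Ω <;> simp [hx]
  simp only [Measure.restrict_univ]
  simp_rw [hL, hR]
  rw [integral_indicator hΩo.measurableSet, integral_indicator hΩo.measurableSet]
  simp_rw [fderiv_mul_smooth_apply hχ hζ] at h1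
  have hw : Continuous fun x => fderiv ℝ ζ x w :=
    (hζ.continuous_fderiv (by simp)).clm_apply continuous_const
  have hwχ : Continuous fun x => fderiv ℝ χ x w :=
    (hχ.continuous_fderiv (by simp)).clm_apply continuous_const
  have i1 : Integrable (fun x => u x * (χ x * fderiv ℝ ζ x w)) (vol Ω) := by
    have hc : HasCompactSupport fun x => fderiv ℝ ζ x w :=
      (hζc.fderiv ℝ).comp_left (g := fun L : E n →L[ℝ] ℝ => L w) rfl
    have := hu.integrable_smul_of_hasCompactSupport hp1 (hχ.continuous.mul hw) (hc.mul_left)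
    exact this.congr (Eventually.of_forall fun x => by simp; ring)
  have i2 : Integrable (fun x => u x * (ζ x * fderiv ℝ χ x w)) (vol Ω) := by
    have := hu.integrable_smul_of_hasCompactSupport hp1 (hζ.continuous.mul hwχ) (hζc.mul_right)
    exact this.congr (Eventually.of_forall fun x => by simp; ring)
  have i3 : Integrable (fun x => inner ℝ (g x) w * (χ x * ζ x)) (vol Ω) := by
    have := hg.integrable_smul_of_hasCompactSupport hp1 (hχ.continuous.mul hζ.continuous)
      (hζc.mul_left)
    exact (this.inner_const (𝕜 := ℝ) w).congr (Eventually.of_forall fun x => by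
      simp [inner_smul_left]; ring)
  simp_rw [mul_add] at h1
  rw [integral_add i1 i2] at h1
  have h2 : ∀ x, inner ℝ (χ x • g x + u x • gradient χ x) w * ζ x
      = inner ℝ (g x) w * (χ x * ζ x) + u x * (ζ x * fderiv ℝ χ x w) := fun x => by
    rw [inner_add_left, inner_smul_left, inner_smul_left, inner_gradient_left]
    simp; ring
  simp_rw [h2]
  rw [integral_add i3 i2]
  have h3 : ∀ x, χ x * u x * fderiv ℝ ζ x w = u x * (χ x * fderiv ℝ ζ x w) := fun x => by ring
  simp_rw [h3]
  linarith

theorem MeasureTheory.MemLp.continuous_smul_of_hasCompactSupport {n : ℕ} {V W : Type*}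
    [NormedAddCommGroup V] [NormedAddCommGroup W] [NormedSpace ℝ W]
    {μ : Measure (E n)} {p : ℝ≥0∞} {u : E n → ℝ} (hu : MemLp u p μ)
    {ζ : E n → W} (hζ : Continuous ζ) (hζc : HasCompactSupport ζ) :
    MemLp (fun x => u x • ζ x) p μ := by
  obtain ⟨C, hC⟩ := hζ.bounded_above_of_compact_support hζc
  refine hu.of_le_mul (c := C) (hu.1.smul hζ.aestronglyMeasurable)
    (Eventually.of_forall fun x => ?_)
  rw [norm_smul, mul_comm]
  exact mul_le_mul_of_nonneg_right (hC x) (norm_nonneg _)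

theorem MeasureTheory.MemLp.smul_continuous_of_hasCompactSupport {n : ℕ} {W : Type*}
    [NormedAddCommGroup W] [NormedSpace ℝ W]
    {μ : Measure (E n)} {p : ℝ≥0∞} {u : E n → W} (hu : MemLp u p μ)
    {ζ : E n → ℝ} (hζ : Continuous ζ) (hζc : HasCompactSupport ζ) :
    MemLp (fun x => ζ x • u x) p μ := by
  obtain ⟨C, hC⟩ := hζ.bounded_above_of_compact_support hζc
  refine hu.of_le_mul (c := C) (hζ.aestronglyMeasurable.smul hu.1)
    (Eventually.of_forall fun x => ?_)
  rw [norm_smul]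
  exact mul_le_mul_of_nonneg_right (hC x) (norm_nonneg _)

/-- A function whose extension by zero is weakly differentiable is a limit of test functions. -/
theorem HasZeroExtGrad.exists_isTest_near {n : ℕ} {Ω : Set (E n)} (hΩo : IsOpen Ω)
    (hΩb : Bornology.IsBounded Ω) (hΩ : HasC1Boundary Ω) {p : ℝ≥0∞} (hp1 : 1 ≤ p) (hp : p ≠ ⊤)
    {u : E n → ℝ} {g : E n → E n} (hu : MemLp u p (vol Ω)) (hg : MemLp g p (vol Ω))
    (h : HasZeroExtGrad Ω u g) {ε : ℝ≥0∞} (hε : ε ≠ 0) :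
    ∃ Ψ, IsTest Ω Ψ ∧ eLpNorm (Ψ - u) p (vol Ω) ≤ ε ∧
      eLpNorm (gradient Ψ - g) p (vol Ω) ≤ ε := by
  choose U e hU hxU hpush using exists_push_inside hΩo hΩ
  have hK : IsCompact (closure Ω) := hΩb.isCompact_closure
  obtain ⟨t, χ, hχ, hχ1⟩ := exists_finite_partition hK U hU hxU
  let v : t → E n → ℝ := fun i => Ω.indicator fun x => χ i x * u x
  let G : t → E n → E n := fun i => Ω.indicator fun x => χ i x • g x + u x • gradient (χ i) x
  have hv : ∀ i, MemLp (v i) p volume := fun i => by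
    rw [memLp_indicator_iff_restrict hΩo.measurableSet]
    exact hu.smul_continuous_of_hasCompactSupport (hχ i).1.continuous (hχ i).2.1
  have hG : ∀ i, MemLp (G i) p volume := fun i => by
    rw [memLp_indicator_iff_restrict hΩo.measurableSet]
    exact (hg.smul_continuous_of_hasCompactSupport (hχ i).1.continuous (hχ i).2.1).add
      (hu.continuous_smul_of_hasCompactSupport (V := ℝ) (continuous_gradient (hχ i).1)
        (hasCompactSupport_gradient (hχ i).2.1))
  have hδ : ε / (t.card + 1) ≠ 0 := ENNReal.div_ne_zero.2 ⟨hε, by finiteness⟩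
  have hex : ∀ i : t, ∃ Ψ, IsTest Ω Ψ ∧ eLpNorm (Ψ - v i) p volume ≤ ε / (t.card + 1) ∧
      eLpNorm (gradient Ψ - G i) p volume ≤ ε / (t.card + 1) := fun i => by
    refine exists_isTest_near_of_push hΩo hp1 hp (K := tsupport (χ i) ∩ closure Ω)
      ((hχ i).2.1.isCompact.inter_right isClosed_closure)
      (hpush i _ (hχ i).2.2 (hχ i).2.1.isCompact) (hv i) (hG i) (fun x hx => ?_)
      (h.mul_smooth hΩo hp1 hu hg (hχ i).1) hδ
    by_cases hxΩ : x ∈ Ω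
    · have : x ∉ tsupport (χ i) := fun h => hx ⟨h, subset_closure hxΩ⟩
      simp [v, image_eq_zero_of_notMem_tsupport this]
    · simp [v, hxΩ]
  choose Ψ hΨ hΨv hΨG using hex
  have hsum : ∑ _i : t, ε / ((t.card : ℝ≥0∞) + 1) ≤ ε := by
    rw [Finset.sum_const, Finset.card_univ, Fintype.card_coe, nsmul_eq_mul, ← mul_div_assoc,
      mul_comm, mul_div_assoc]
    refine mul_le_of_le_one_right' (ENNReal.div_le_of_le_mul ?_)
    rw [one_mul]; exact le_self_add
  have hT : IsCompact (⋃ i, tsupport (Ψ i)) := isCompact_iUnion fun i => (hΨ i).2.1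
  have hsupp : Function.support (fun x => ∑ i, Ψ i x) ⊆ ⋃ i, tsupport (Ψ i) := fun x hx => by
    obtain ⟨i, -, hi⟩ := Finset.exists_ne_zero_of_sum_ne_zero hx
    exact mem_iUnion.2 ⟨i, subset_tsupport _ hi⟩
  refine ⟨fun x => ∑ i, Ψ i x, ⟨ContDiff.sum fun i _ => (hΨ i).1,
    HasCompactSupport.of_support_subset_isCompact hT hsupp,
    (closure_minimal hsupp hT.isClosed).trans (iUnion_subset fun i => (hΨ i).2.2)⟩, ?_, ?_⟩
  · have heq : (fun x => ∑ i, Ψ i x) - u =ᵐ[vol Ω] ∑ i, (Ψ i - v i) := by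
      filter_upwards [ae_restrict_mem hΩo.measurableSet] with x hx
      simp only [Pi.sub_apply, Finset.sum_apply, Finset.sum_sub_distrib, v,
        indicator_of_mem hx]
      rw [← Finset.sum_mul, hχ1 x (subset_closure hx), one_mul]
    rw [eLpNorm_congr_ae heq]
    refine (eLpNorm_sum_le (fun i _ => ?_) hp1).trans (le_trans (Finset.sum_le_sum fun i _ => ?_) hsum)
    · exact ((hΨ i).1.continuous.aestronglyMeasurable.sub (hv i).1).restrict
    · exact (eLpNorm_mono_measure _ Measure.restrict_le_self).trans (hΨv i)
  · have heq : gradient (fun x => ∑ i, Ψ i x) - g =ᵐ[vol Ω] ∑ i, (gradient (Ψ i) - G i) := by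
      filter_upwards [ae_restrict_mem hΩo.measurableSet] with x hx
      -- The functions `χ i` sum to `1` on a neighbourhood of `x`, so the terms `u ∇χ i` cancel.
      have hz : ∑ i, gradient (χ i) x = 0 := by
        rw [← gradient_finset_sum _ fun i => (hχ i).1]
        have : (fun y => ∑ i, χ i y) =ᶠ[𝓝 x] fun _ => (1 : ℝ) := by
          filter_upwards [hΩo.mem_nhds hx] with y hy using hχ1 y (subset_closure hy)
        rw [gradient, this.fderiv_eq]
        simp
      simp only [Pi.sub_apply, Finset.sum_apply, Finset.sum_sub_distrib, G,
        indicator_of_mem hx, gradient_finset_sum _ fun i => (hΨ i).1, Finset.sum_add_distrib]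
      rw [← Finset.sum_smul, ← Finset.smul_sum, hz, hχ1 x (subset_closure hx), one_smul,
        smul_zero, add_zero]
    rw [eLpNorm_congr_ae heq]
    refine (eLpNorm_sum_le (fun i _ => ?_) hp1).trans (le_trans (Finset.sum_le_sum fun i _ => ?_) hsum)
    · exact ((continuous_gradient (hΨ i).1).aestronglyMeasurable.sub (hG i).1).restrict
    · exact (eLpNorm_mono_measure _ Measure.restrict_le_self).trans (hΨG i)

/-! ### Graph coordinates and a boundary estimate. -/

/-- Orthonormal coordinates in which the unit vector `e` is the last coordinate direction. -/
theorem exists_adapted_coordinates {m : ℕ} {e : E (m + 1)} (he : ‖e‖ = 1) :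
    ∃ P : ((Fin m → ℝ) × ℝ) ≃L[ℝ] E (m + 1),
      MeasurePreserving P volume volume ∧ P (0, 1) = e ∧
      (∀ y t, inner ℝ e (P (y, t)) = t) ∧ ∀ y t, ‖y‖ ≤ ‖P (y, t)‖ := by
  -- The one-vector family `e` is completed to an orthonormal basis with `e` at index `0`; `t` is
  -- that coordinate and `y` collects the others.
  have hv : Orthonormal ℝ (({0} : Set (Fin (m + 1))).domRestrict fun _ => e) :=
    ⟨fun _ => he, fun i j hij => absurd (Subsingleton.elim i j) hij⟩
  obtain ⟨B, hB⟩ := hv.exists_orthonormalBasis_extension_of_card_eq (by simp)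
  have hB0 : B 0 = e := hB 0 rfl
  let P : ((Fin m → ℝ) × ℝ) ≃L[ℝ] E (m + 1) :=
    ((ContinuousLinearEquiv.prodComm ℝ (Fin m → ℝ) ℝ).trans
      (Fin.consEquivL ℝ (fun _ : Fin (m + 1) => ℝ))).trans
      ((EuclideanSpace.equiv (Fin (m + 1)) ℝ).symm.trans
        B.repr.symm.toContinuousLinearEquiv)
  have hP : ∀ y t, P (y, t) = B.repr.symm (WithLp.toLp 2 (Fin.cons t y)) := fun y t => rfl
  have hrepr : ∀ y t, B.repr (P (y, t)) = WithLp.toLp 2 (Fin.cons t y) := fun y t => by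
    rw [hP, LinearIsometryEquiv.apply_symm_apply]
  refine ⟨P, ?_, ?_, fun y t => ?_, fun y t => ?_⟩
  · have h1 := (volume_preserving_piFinSuccAbove (fun _ : Fin (m + 1) => ℝ) 0).symm
    have h2 : MeasurePreserving (Prod.swap : (Fin m → ℝ) × ℝ → ℝ × (Fin m → ℝ))
      volume volume := Measure.measurePreserving_swap
    have h3 := (B.measurePreserving_repr_symm.comp
      (PiLp.volume_preserving_toLp (Fin (m + 1)))).comp (h1.comp h2)
    convert h3 using 1
    ext1 ⟨y, t⟩
    rw [hP]
    simp only [MeasurableEquiv.piFinSuccAbove, Function.comp_apply, Prod.swap]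
    congr 2
    exact (Fin.insertNth_zero' t y).symm
  · rw [hP, ← hB0, LinearIsometryEquiv.symm_apply_eq, B.repr_self]
    ext i
    refine Fin.cases ?_ (fun j => ?_) i <;> simp
  · rw [← hB0, ← B.repr_apply_apply, hrepr]
    simp
  · rw [← B.repr.norm_map (P (y, t)), hrepr]
    refine (pi_norm_le_iff_of_nonneg (norm_nonneg _)).2 fun i => ?_
    have := PiLp.norm_apply_le (p := 2) (WithLp.toLp 2 (Fin.cons t y) : E (m + 1)) i.succ
    simpa using this

theorem HasCompactSupport.slice_left {X Y : Type*} [TopologicalSpace X] [TopologicalSpace Y]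
    [R1Space X] {G : X × Y → ℝ} (hG : HasCompactSupport G) (t : Y) :
    HasCompactSupport fun y => G (y, t) :=
  HasCompactSupport.of_support_subset_isCompact (hG.isCompact.image continuous_fst)
    fun y hy => ⟨(y, t), subset_tsupport _ hy, rfl⟩

theorem HasCompactSupport.slice_right {X Y : Type*} [TopologicalSpace X] [TopologicalSpace Y]
    [R1Space Y] {G : X × Y → ℝ} (hG : HasCompactSupport G) (y : X) :
    HasCompactSupport fun t => G (y, t) :=
  HasCompactSupport.of_support_subset_isCompact (hG.isCompact.image continuous_snd)
    fun t ht => ⟨(y, t), subset_tsupport _ ht, rfl⟩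

theorem integral_fderiv_apply_eq_zero {m : ℕ} {g : (Fin m → ℝ) → ℝ} (hg : ContDiff ℝ 1 g)
    (hgc : HasCompactSupport g) (b : Fin m → ℝ) : ∫ y, fderiv ℝ g y b = 0 := by
  have h1 : Integrable fun y => fderiv ℝ g y b :=
    ((hg.continuous_fderiv (by simp)).clm_apply continuous_const).integrable_of_hasCompactSupport
      ((hgc.fderiv ℝ).comp_left (g := fun L : (Fin m → ℝ) →L[ℝ] ℝ => L b) rfl)
  have := integral_mul_fderiv_eq_neg_fderiv_mul_of_integrable (μ := volume)
    (f := fun _ : Fin m → ℝ => (1 : ℝ)) (g := g) (v := b) (by simp) (by simpa using h1)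
    (by simpa using hg.continuous.integrable_of_hasCompactSupport hgc)
    (by simp) (fun x _ => (hg.differentiable one_ne_zero) x)
  simpa using this

/-- The divergence theorem for the half space `t > 0`, in a direction that depends on the
tangential variables. -/
theorem setIntegral_halfSpace_fderiv {m : ℕ} {G : (Fin m → ℝ) × ℝ → ℝ} (hG : ContDiff ℝ 1 G)
    (hGc : HasCompactSupport G) {c : (Fin m → ℝ) → ℝ} (hc : Continuous c) (b : Fin m → ℝ) :
    ∫ z in univ ×ˢ Ioi (0 : ℝ), fderiv ℝ G z (b, c z.1) = - ∫ y, c y * G (y, 0) := by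
  have hcont : ∀ v : (Fin m → ℝ) × ℝ → (Fin m → ℝ) × ℝ, Continuous v →
      Continuous fun z => fderiv ℝ G z (v z) := fun v hv =>
    (hG.continuous_fderiv (by simp)).clm_apply hv
  have hcomp : ∀ v : (Fin m → ℝ) × ℝ → (Fin m → ℝ) × ℝ,
      HasCompactSupport fun z => fderiv ℝ G z (v z) := fun v => by
    refine (hGc.fderiv ℝ).mono fun z hz => ?_
    intro h0
    exact hz (by simp [h0])
  have hint : ∀ v : (Fin m → ℝ) × ℝ → (Fin m → ℝ) × ℝ, Continuous v →
      Integrable fun z => fderiv ℝ G z (v z) := fun v hv =>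
    (hcont v hv).integrable_of_hasCompactSupport (hcomp v)
  -- The constant tangential part integrates to zero on each slice of fixed `t`; on each vertical
  -- line `c` is constant and the fundamental theorem of calculus leaves the boundary value.
  have hsplit : ∀ z : (Fin m → ℝ) × ℝ, fderiv ℝ G z (b, c z.1)
      = fderiv ℝ G z (b, 0) + fderiv ℝ G z (0, c z.1) := fun z => by
    rw [← map_add]; simp
  simp_rw [hsplit]
  rw [integral_add (hint _ continuous_const).integrableOn
    (hint (fun z => (0, c z.1)) (by fun_prop)).integrableOn]
  have hvol : (volume.restrict (univ ×ˢ Ioi (0 : ℝ)) : Measure ((Fin m → ℝ) × ℝ))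
      = (volume : Measure (Fin m → ℝ)).prod (volume.restrict (Ioi 0)) := by
    rw [Measure.volume_eq_prod, ← Measure.prod_restrict, Measure.restrict_univ]
  have h1 : ∫ z in univ ×ˢ Ioi (0 : ℝ), fderiv ℝ G z (b, 0) = 0 := by
    have hi := (hint (fun _ => (b, 0)) continuous_const).integrableOn (s := univ ×ˢ Ioi (0 : ℝ))
    rw [IntegrableOn, hvol] at hi
    rw [hvol, integral_prod_symm _ hi]
    refine integral_eq_zero_of_ae (Eventually.of_forall fun t => ?_)
    have hd : ∀ y, fderiv ℝ (fun y => G (y, t)) y b = fderiv ℝ G (y, t) (b, 0) := fun y => by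
      have h2 := ((hG.differentiable one_ne_zero) (y, t)).hasFDerivAt.comp (f := fun y => (y, t)) y
        (hasFDerivAt_prodMk_left y t)
      have h3 : HasFDerivAt (fun y => G (y, t)) _ y := h2
      rw [h3.fderiv]; simp
    have h4 := integral_fderiv_apply_eq_zero (g := fun y => G (y, t))
      (hG.comp (contDiff_id.prodMk contDiff_const))
      (hGc.slice_left t) b
    simpa [hd] using h4
  have h2 : ∫ z in univ ×ˢ Ioi (0 : ℝ), fderiv ℝ G z (0, c z.1) = - ∫ y, c y * G (y, 0) := by
    have hi := (hint (fun z => (0, c z.1)) (by fun_prop)).integrableOn (s := univ ×ˢ Ioi (0 : ℝ))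
    rw [IntegrableOn, hvol] at hi
    rw [hvol, integral_prod _ hi, ← integral_neg]
    refine integral_congr_ae (Eventually.of_forall fun y => ?_)
    have hd : ∀ t, fderiv ℝ G (y, t) (0, c y) = c y * deriv (fun t => G (y, t)) t := fun t => by
      have h2 := ((hG.differentiable one_ne_zero) (y, t)).hasFDerivAt.comp (f := fun t => (y, t)) t
        (hasFDerivAt_prodMk_right y t)
      have h3 : HasFDerivAt (fun t => G (y, t)) _ t := h2
      rw [h3.hasDerivAt.deriv]
      have : ((0 : Fin m → ℝ), c y) = c y • ((0 : Fin m → ℝ), (1 : ℝ)) := by simp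
      rw [this, map_smul]
      simp
    have h4 := HasCompactSupport.integral_Ioi_deriv_eq (f := fun t => G (y, t))
      (hG.comp (contDiff_const.prodMk contDiff_id))
      (hGc.slice_right y) 0
    simp only [hd]
    rw [integral_const_mul, h4, mul_neg]
  rw [h1, h2, zero_add]

/-- The shear `(y, t) ↦ (y, t + H y)`. -/
def shearHomeomorph {Y : Type*} [TopologicalSpace Y] (H : C(Y, ℝ)) : Y × ℝ ≃ₜ Y × ℝ where
  toFun z := (z.1, z.2 + H z.1)
  invFun z := (z.1, z.2 - H z.1)
  left_inv z := by simp
  right_inv z := by simp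
  continuous_toFun := by fun_prop
  continuous_invFun := by fun_prop

theorem measurePreserving_shearHomeomorph {m : ℕ} (H : C(Fin m → ℝ, ℝ)) :
    MeasurePreserving (shearHomeomorph H) volume volume :=
  MeasurePreserving.skew_product (μa := (volume : Measure (Fin m → ℝ)))
    (μc := (volume : Measure ℝ)) (MeasurePreserving.id _)
    (g := fun y t => t + H y) (by fun_prop)
    (Eventually.of_forall fun y => (measurePreserving_add_right volume (H y)).map_eq)

/-- Where the boundary is a graph over a hyperplane, the integral of a directional derivative over
the domain is controlled by a finite measure on the boundary that is dominated by the surface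
measure. -/
theorem exists_finite_measure_le_surf {m : ℕ} {Ω : Set (E (m + 1))} (hΩo : IsOpen Ω)
    {x₀ e : E (m + 1)} {r : ℝ} {h : E (m + 1) → ℝ} (he : ‖e‖ = 1) (hh : ContDiff ℝ 1 h)
    (hgr : ∀ x ∈ Metric.ball x₀ r, (x ∈ Ω ↔ h (x - inner ℝ e x • e) < inner ℝ e x)) :
    ∃ ν : Measure (E (m + 1)), IsFiniteMeasure ν ∧ ν ≤ surf Ω ∧ ∀ w, ∃ C : ℝ, ∀ g,
      ContDiff ℝ 1 g → HasCompactSupport g → tsupport g ⊆ Metric.ball x₀ r →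
      |∫ x in Ω, fderiv ℝ g x w| ≤ C * ∫ x, |g x| ∂ν := by
  obtain ⟨P, hPm, hPe, hPi, hPn⟩ := exists_adapted_coordinates he
  have hPadd : ∀ y t, P (y, t) = P (y, 0) + t • e := fun y t => by
    rw [← hPe, ← map_smul, ← map_add]; simp
  let H : (Fin m → ℝ) → ℝ := fun y => h (P (y, 0))
  have hH : ContDiff ℝ 1 H := hh.comp (P.contDiff.comp (contDiff_id.prodMk contDiff_const))
  have hPH : ∀ y t, h (P (y, t) - inner ℝ e (P (y, t)) • e) = H y := fun y t => by
    rw [hPi, hPadd y t, add_sub_cancel_right]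
  -- The shear flattens the graph of `H` to `t = 0` and preserves volume, so no Jacobian appears.
  let S := shearHomeomorph ⟨H, hH.continuous⟩
  have hS : ∀ z, S z = (z.1, z.2 + H z.1) := fun z => rfl
  have hSd : ContDiff ℝ 1 S :=
    contDiff_fst.prodMk (contDiff_snd.add (hH.comp contDiff_fst))
  let Q : (Fin m → ℝ) × ℝ ≃ₜ E (m + 1) := S.trans P.toHomeomorph
  have hQ : ∀ z, Q z = P (S z) := fun z => rfl
  have hQm : MeasurePreserving Q volume volume :=
    hPm.comp (measurePreserving_shearHomeomorph _)
  have hQd : ContDiff ℝ 1 Q := P.contDiff.comp hSd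
  have hQΩ : ∀ z, Q z ∈ Metric.ball x₀ r → (Q z ∈ Ω ↔ 0 < z.2) := fun z hz => by
    rw [hgr _ hz, hQ, hS, hPH, hPi]; simp
  let γ : (Fin m → ℝ) → E (m + 1) := fun y => Q (y, 0)
  have hγ : Continuous γ := Q.continuous.comp (by fun_prop)
  have hγn : ∀ y, ‖y‖ ≤ ‖γ y‖ := fun y => hPn y _
  let Y : Set (Fin m → ℝ) := γ ⁻¹' Metric.ball x₀ r
  have hYo : IsOpen Y := Metric.isOpen_ball.preimage hγ
  have hYb : Y ⊆ Metric.closedBall 0 (‖x₀‖ + r) := fun y hy => by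
    have : ‖γ y‖ ≤ ‖x₀‖ + r := (norm_lt_of_mem_ball hy).le
    simpa using (hγn y).trans this
  have hYfin : volume Y < ⊤ :=
    (measure_mono hYb).trans_lt (isCompact_closedBall _ _).measure_lt_top
  have hfr : ∀ y ∈ Y, γ y ∈ frontier Ω := fun y hy => by
    rw [hΩo.frontier_eq]
    refine ⟨?_, fun hcon => lt_irrefl _ ((hQΩ (y, 0) hy).1 hcon)⟩
    have hlim : Tendsto (fun t : ℝ => Q (y, t)) (𝓝[>] 0) (𝓝 (γ y)) :=
      ((Q.continuous.comp (by fun_prop : Continuous fun t : ℝ => (y, t))).tendsto 0).mono_left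
        nhdsWithin_le_nhds
    refine mem_closure_of_tendsto hlim ?_
    filter_upwards [hlim.eventually (Metric.isOpen_ball.mem_nhds hy), self_mem_nhdsWithin]
      with t ht ht0
    exact (hQΩ (y, t) ht).2 ht0
  -- `ν` is surface measure without the factor `√(1 + |∇H|²)`: Lebesgue measure on the bounded base
  -- `Y`, carried to the graph. Only `ν ≤ surf Ω` is needed, and this holds because projection to
  -- the base is 1-Lipschitz.
  let ν : Measure (E (m + 1)) := (volume.restrict Y).map γ
  refine ⟨ν, ?_, ?_, fun w => ?_⟩
  · have : IsFiniteMeasure ((volume : Measure (Fin m → ℝ)).restrict Y) :=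
      ⟨by simpa using hYfin⟩
    exact Measure.isFiniteMeasure_map _ _
  · refine Measure.le_iff.2 fun s hs => ?_
    have hdim : ((m + 1 : ℕ) : ℝ) - 1 = (Fintype.card (Fin m) : ℝ) := by simp
    rw [Measure.map_apply hγ.measurable hs, Measure.restrict_apply (hγ.measurable hs), surf,
      Measure.restrict_apply hs, hdim]
    have hlip : LipschitzWith 1 fun x : E (m + 1) => (P.symm x).1 := by
      refine LipschitzWith.of_dist_le_mul fun x x' => ?_
      rw [dist_eq_norm, dist_eq_norm, ← Prod.fst_sub, ← map_sub, NNReal.coe_one, one_mul]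
      have := hPn (P.symm (x - x')).1 (P.symm (x - x')).2
      rwa [Prod.mk.eta, P.apply_symm_apply] at this
    have h1 := hlip.hausdorffMeasure_image_le (d := Fintype.card (Fin m)) (by positivity)
      (s ∩ frontier Ω)
    -- With the sup norm on `Fin m → ℝ`, Hausdorff measure equals Lebesgue measure with constant
    -- one; this is why the base is not `E m`.
    rw [hausdorffMeasure_pi_real] at h1
    simp only [ENNReal.coe_one, ENNReal.one_rpow, one_mul] at h1
    refine (measure_mono ?_).trans h1
    rintro y ⟨hys, hyY⟩
    refine ⟨γ y, ⟨hys, hfr y hyY⟩, ?_⟩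
    simp [γ, hQ, hS]
  · obtain ⟨⟨b, a⟩, rfl⟩ := P.surjective w
    -- The derivative of the shear sends `(b, c y)` to `(b, a)`, so this is the direction `w` in
    -- flattened coordinates.
    let c : (Fin m → ℝ) → ℝ := fun y => a - fderiv ℝ H y b
    have hc : Continuous c :=
      continuous_const.sub ((hH.continuous_fderiv (by simp)).clm_apply continuous_const)
    obtain ⟨C, hC⟩ := (isCompact_closedBall (0 : Fin m → ℝ) (‖x₀‖ + r)).exists_bound_of_continuousOn
      hc.continuousOn
    refine ⟨C, fun g hg hgc hgs => ?_⟩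
    let G : (Fin m → ℝ) × ℝ → ℝ := fun z => g (Q z)
    have hG : ContDiff ℝ 1 G := hg.comp hQd
    have hGc : HasCompactSupport G := hgc.comp_homeomorph Q
    have hDG : ∀ z, fderiv ℝ G z (b, c z.1) = fderiv ℝ g (Q z) (P (b, a)) := fun z => by
      have h1 : HasFDerivAt S ((ContinuousLinearMap.fst ℝ (Fin m → ℝ) ℝ).prod
          (ContinuousLinearMap.snd ℝ (Fin m → ℝ) ℝ +
            (fderiv ℝ H z.1).comp (ContinuousLinearMap.fst ℝ (Fin m → ℝ) ℝ))) z :=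
        hasFDerivAt_fst.prodMk (hasFDerivAt_snd.add
          (((hH.differentiable one_ne_zero) z.1).hasFDerivAt.comp z hasFDerivAt_fst))
      have h2 := ((hg.differentiable one_ne_zero) (Q z)).hasFDerivAt.comp z
        (P.hasFDerivAt.comp z h1)
      have h3 : HasFDerivAt G _ z := h2
      rw [h3.fderiv]
      simp [c]
    have hzero : ∀ x, x ∉ Metric.ball x₀ r → fderiv ℝ g x = 0 := fun x hx =>
      image_eq_zero_of_notMem_tsupport fun hcon => hx (hgs (tsupport_fderiv_subset ℝ hcon))
    have hI : ∫ x in Ω, fderiv ℝ g x (P (b, a)) = - ∫ y, c y * G (y, 0) := by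
      rw [← setIntegral_halfSpace_fderiv hG hGc hc b, ← integral_indicator hΩo.measurableSet,
        ← hQm.integral_comp Q.measurableEmbedding,
        ← integral_indicator (MeasurableSet.univ.prod measurableSet_Ioi)]
      refine integral_congr_ae (Eventually.of_forall fun z => ?_)
      by_cases hz : Q z ∈ Metric.ball x₀ r
      · have hiff := hQΩ z hz
        by_cases hz0 : 0 < z.2
        · simp [hiff, indicator, hz0, hDG]
        · simp [hiff, indicator, hz0]
      · have h0 := hzero _ hz
        simp [indicator, hDG, h0]
    have hGY : ∀ y, y ∉ Y → G (y, 0) = 0 := fun y hy =>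
      image_eq_zero_of_notMem_tsupport (f := g) fun hcon => hy (hgs hcon)
    have hG0c : HasCompactSupport fun y => G (y, 0) := hGc.slice_left 0
    have hG0 : Continuous fun y => G (y, 0) := hG.continuous.comp (by fun_prop)
    rw [hI, abs_neg]
    calc |∫ y, c y * G (y, 0)| ≤ ∫ y, |c y * G (y, 0)| := abs_integral_le_integral_abs
      _ = ∫ y in Y, |c y * G (y, 0)| := by
          rw [setIntegral_eq_integral_of_forall_compl_eq_zero]
          intro y hy
          simp [hGY y hy]
      _ ≤ ∫ y in Y, C * |G (y, 0)| := by
          refine setIntegral_mono_on ?_ ?_ hYo.measurableSet fun y hy => ?_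
          · exact ((hc.mul hG0).abs.integrable_of_hasCompactSupport
              (hG0c.mul_left.comp_left (g := fun x : ℝ => |x|) abs_zero)).integrableOn
          · exact ((hG0.abs.integrable_of_hasCompactSupport
              (hG0c.comp_left (g := fun x : ℝ => |x|) abs_zero)).const_mul C).integrableOn
          · rw [abs_mul]
            exact mul_le_mul_of_nonneg_right (hC y (hYb hy)) (abs_nonneg _)
      _ = C * ∫ x, |g x| ∂ν := by
          rw [integral_const_mul, integral_map hγ.measurable.aemeasurable
            hg.continuous.abs.aestronglyMeasurable]

/-! ### Uniqueness of weak gradients and divergences. -/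

theorem MeasureTheory.LocallyIntegrableOn.integrable_smul_of_tsupport_subset {n : ℕ}
    {V : Type*} [NormedAddCommGroup V] [NormedSpace ℝ V] {Ω : Set (E n)} {f : E n → V}
    (hf : LocallyIntegrableOn f Ω volume) {ψ : E n → ℝ} (hψ : Continuous ψ)
    (hψc : HasCompactSupport ψ) (hψΩ : tsupport ψ ⊆ Ω) : Integrable fun x => ψ x • f x := by
  have h1 := hf.integrableOn_compact_subset hψΩ hψc.isCompact
  have h2 : IntegrableOn (fun x => ψ x • f x) (tsupport ψ) :=
    h1.continuousOn_smul hψ.continuousOn hψc.isCompact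
  rwa [integrableOn_iff_integrable_of_support_subset] at h2
  intro x hx
  exact subset_tsupport _ fun h0 => hx (by simp [h0])

theorem setIntegral_smul_eq_integral_of_tsupport_subset {n : ℕ} {V : Type*}
    [NormedAddCommGroup V] [NormedSpace ℝ V] {Ω : Set (E n)} {f : E n → V}
    {ψ : E n → ℝ} (hψΩ : tsupport ψ ⊆ Ω) : ∫ x in Ω, ψ x • f x = ∫ x, ψ x • f x :=
  setIntegral_eq_integral_of_forall_compl_eq_zero fun x hx => by
    rw [image_eq_zero_of_notMem_tsupport fun h => hx (hψΩ h), zero_smul]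

/-- The fundamental lemma of the calculus of variations. It lets the arbitrarily chosen `weakGrad`
be replaced by any explicit weak gradient. -/
theorem DarcyForchheimer.IsWeakGrad.ae_eq {n : ℕ} {Ω : Set (E n)} (hΩo : IsOpen Ω)
    {u : E n → ℝ} {g g' : E n → E n} (h : IsWeakGrad Ω u g) (h' : IsWeakGrad Ω u g') :
    g =ᵐ[vol Ω] g' := by
  have key : ∀ᵐ x ∂(volume : Measure (E n)), x ∈ Ω → (g - g') x = 0 := by
    refine hΩo.ae_eq_zero_of_integral_contDiff_smul_eq_zero (h.2.1.sub h'.2.1)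
      fun ψ hψ hψc hψΩ => ?_
    have i := h.2.1.integrable_smul_of_tsupport_subset hψ.continuous hψc hψΩ
    have i' := h'.2.1.integrable_smul_of_tsupport_subset hψ.continuous hψc hψΩ
    simp only [Pi.sub_apply, smul_sub]
    rw [integral_sub i i', sub_eq_zero]
    refine ext_inner_left ℝ fun w => ?_
    rw [← integral_inner i, ← integral_inner i']
    have e1 := h.2.2 ψ ⟨hψ, hψc, hψΩ⟩ w
    have e2 := h'.2.2 ψ ⟨hψ, hψc, hψΩ⟩ w
    rw [e1, neg_inj] at e2
    simp_rw [inner_smul_right, real_inner_comm _ w]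
    simp_rw [mul_comm _ (ψ _)] at e2
    have e3 := setIntegral_smul_eq_integral_of_tsupport_subset (f := fun x => inner ℝ (g x) w) hψΩ
    have e4 := setIntegral_smul_eq_integral_of_tsupport_subset (f := fun x => inner ℝ (g' x) w) hψΩ
    simp only [smul_eq_mul] at e3 e4
    rw [← e3, ← e4, e2]
  rw [Filter.EventuallyEq, ae_restrict_iff' hΩo.measurableSet]
  filter_upwards [key] with x hx hxΩ
  exact sub_eq_zero.1 (hx hxΩ)

theorem DarcyForchheimer.IsWeakDiv.ae_eq {n : ℕ} {Ω : Set (E n)} (hΩo : IsOpen Ω)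
    {v : E n → E n} {d d' : E n → ℝ} (h : IsWeakDiv Ω v d) (h' : IsWeakDiv Ω v d') :
    d =ᵐ[vol Ω] d' := by
  have key : ∀ᵐ x ∂(volume : Measure (E n)), x ∈ Ω → (d - d') x = 0 := by
    refine hΩo.ae_eq_zero_of_integral_contDiff_smul_eq_zero (h.2.1.sub h'.2.1)
      fun ψ hψ hψc hψΩ => ?_
    have i := h.2.1.integrable_smul_of_tsupport_subset hψ.continuous hψc hψΩ
    have i' := h'.2.1.integrable_smul_of_tsupport_subset hψ.continuous hψc hψΩ
    simp only [Pi.sub_apply, smul_sub]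
    rw [integral_sub i i', sub_eq_zero]
    have e1 := h.2.2 ψ ⟨hψ, hψc, hψΩ⟩
    have e2 := h'.2.2 ψ ⟨hψ, hψc, hψΩ⟩
    rw [e1, neg_inj] at e2
    simp_rw [mul_comm _ (ψ _)] at e2
    rw [← setIntegral_smul_eq_integral_of_tsupport_subset hψΩ,
      ← setIntegral_smul_eq_integral_of_tsupport_subset hψΩ]
    exact e2
  rw [Filter.EventuallyEq, ae_restrict_iff' hΩo.measurableSet]
  filter_upwards [key] with x hx hxΩ
  exact sub_eq_zero.1 (hx hxΩ)

theorem DarcyForchheimer.MemW1.isWeakGrad_weakGrad {n : ℕ} {Ω : Set (E n)} {s : ℝ≥0∞}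
    {u : E n → ℝ} (h : MemW1 Ω s u) : IsWeakGrad Ω u (weakGrad Ω u) := by
  obtain ⟨-, g, hg, -⟩ := h
  exact weakGrad_spec hg

theorem DarcyForchheimer.MemW1.memLp_weakGrad {n : ℕ} {Ω : Set (E n)} (hΩo : IsOpen Ω)
    {s : ℝ≥0∞} {u : E n → ℝ} (h : MemW1 Ω s u) : MemLp (weakGrad Ω u) s (vol Ω) := by
  obtain ⟨-, g, hg, hgs⟩ := h
  exact (memLp_congr_ae (hg.ae_eq hΩo (weakGrad_spec hg))).1 hgs

theorem DarcyForchheimer.MemWdiv.isWeakDiv_weakDiv {n : ℕ} {Ω : Set (E n)} {s : ℝ≥0∞}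
    {v : E n → E n} (h : MemWdiv Ω s v) : IsWeakDiv Ω v (weakDiv Ω v) := by
  obtain ⟨-, d, hd, -⟩ := h
  exact weakDiv_spec hd

theorem DarcyForchheimer.MemWdiv.memLp_weakDiv {n : ℕ} {Ω : Set (E n)} (hΩo : IsOpen Ω)
    {s : ℝ≥0∞} {v : E n → E n} (h : MemWdiv Ω s v) : MemLp (weakDiv Ω v) s (vol Ω) := by
  obtain ⟨-, d, hd, hds⟩ := h
  exact (memLp_congr_ae (hd.ae_eq hΩo (weakDiv_spec hd))).1 hds

/-! ### Zero trace implies a weakly differentiable zero extension. -/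

/-- Integrals depend continuously on `L^s`-convergent data. -/
theorem tendsto_integral_of_tendsto_eLpNorm {α V : Type*} [MeasurableSpace α]
    [NormedAddCommGroup V] {μ : Measure α} [IsFiniteMeasure μ] {s : ℝ≥0∞} (hs : 1 ≤ s)
    {f : ℕ → α → V} {f₀ : α → V} (hf : ∀ j, AEStronglyMeasurable (f j - f₀) μ)
    (hlim : Tendsto (fun j => eLpNorm (f j - f₀) s μ) atTop (𝓝 0))
    {a : ℕ → α → ℝ} {a₀ : α → ℝ} (ha : ∀ j, Integrable (a j) μ) (ha₀ : Integrable a₀ μ) (M : ℝ)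
    (hM : ∀ j, ∀ᵐ x ∂μ, ‖a j x - a₀ x‖ ≤ M * ‖f j x - f₀ x‖) :
    Tendsto (fun j => ∫ x, a j x ∂μ) atTop (𝓝 (∫ x, a₀ x ∂μ)) := by
  refine tendsto_integral_of_L1' a₀ ha₀.1 (Eventually.of_forall ha) ?_
  have hb : ∀ j, eLpNorm (a j - a₀) 1 μ ≤ ENNReal.ofReal M *
      (eLpNorm (f j - f₀) s μ * μ Set.univ ^ (1 / (1 : ℝ≥0∞).toReal - 1 / s.toReal)) := fun j =>
    (eLpNorm_le_mul_eLpNorm_of_ae_le_mul (hM j) 1).trans (by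
      gcongr
      exact eLpNorm_le_eLpNorm_mul_rpow_measure_univ hs (hf j))
  -- For `s = ⊤` the conventions `⊤.toReal = 0` and `1 / 0 = 0` give the correct exponent `1`.
  have hexp : 0 ≤ 1 / (1 : ℝ≥0∞).toReal - 1 / s.toReal := by
    rcases eq_or_ne s ⊤ with rfl | hs'
    · simp
    · have : 1 ≤ s.toReal := by simpa using ENNReal.toReal_mono hs' hs
      have : 1 / s.toReal ≤ 1 := (div_le_one (by linarith)).2 this
      simpa using this
  refine tendsto_of_tendsto_of_tendsto_of_le_of_le tendsto_const_nhds ?_ (fun _ => zero_le) hb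
  have hC : μ Set.univ ^ (1 / (1 : ℝ≥0∞).toReal - 1 / s.toReal) ≠ ⊤ :=
    ENNReal.rpow_ne_top_of_nonneg hexp (measure_ne_top _ _)
  have h1 := ENNReal.Tendsto.mul_const (b := μ Set.univ ^ (1 / (1 : ℝ≥0∞).toReal - 1 / s.toReal))
    hlim (Or.inr hC)
  have h2 := ENNReal.Tendsto.const_mul (a := ENNReal.ofReal M) h1 (Or.inr ENNReal.ofReal_ne_top)
  simpa using h2

/-- Both sides are linear in `ζ`, so a partition of unity on its support localizes the identity.
This separates interior points, exterior points and boundary charts. -/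
theorem hasZeroExtGrad_of_locally {n : ℕ} {Ω : Set (E n)} {p : ℝ≥0∞} (hp1 : 1 ≤ p)
    {u : E n → ℝ} {g : E n → E n} (hu : MemLp u p (vol Ω)) (hg : MemLp g p (vol Ω))
    (h : ∀ x₀, ∃ U, IsOpen U ∧ x₀ ∈ U ∧ ∀ ζ : E n → ℝ, ContDiff ℝ ∞ ζ → HasCompactSupport ζ →
      tsupport ζ ⊆ U → ∀ w : E n,
      ∫ x in Ω, u x * fderiv ℝ ζ x w = - ∫ x in Ω, inner ℝ (g x) w * ζ x) :
    HasZeroExtGrad Ω u g := by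
  intro ζ hζ hζc w
  choose U hU hxU hloc using h
  obtain ⟨t, χ, hχ, hχ1⟩ := exists_finite_partition hζc.isCompact U hU hxU
  have hsum : ∀ x, ∑ i, χ i x * ζ x = ζ x := fun x => by
    by_cases hx : x ∈ tsupport ζ
    · rw [← Finset.sum_mul, hχ1 x hx, one_mul]
    · simp [image_eq_zero_of_notMem_tsupport hx]
  have hd : ∀ i, ContDiff ℝ ∞ fun x => χ i x * ζ x := fun i => (hχ i).1.mul hζ
  have hc : ∀ i, HasCompactSupport fun x => χ i x * ζ x := fun i => hζc.mul_left
  have hgrad : ∀ x, fderiv ℝ ζ x w = ∑ i, fderiv ℝ (fun x => χ i x * ζ x) x w := fun x => by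
    rw [← sum_apply, ← fderiv_fun_sum fun i _ =>
      ((hd i).differentiable (by simp)).differentiableAt]
    simp_rw [hsum]
  have e := fun i : t => hloc i _ (hd i) (hc i) ((tsupport_mul_subset_left).trans (hχ i).2.2) w
  have l1 : ∀ x, u x * fderiv ℝ ζ x w = ∑ i, u x * fderiv ℝ (fun x => χ i x * ζ x) x w :=
    fun x => by rw [hgrad, Finset.mul_sum]
  have l2 : ∀ x, inner ℝ (g x) w * ζ x = ∑ i, inner ℝ (g x) w * (χ i x * ζ x) :=
    fun x => by rw [← Finset.mul_sum, hsum]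
  simp_rw [l1, l2]
  rw [integral_finsetSum, integral_finsetSum, ← Finset.sum_neg_distrib]
  · exact Finset.sum_congr rfl fun i _ => e i
  · intro i _
    have := hg.integrable_smul_of_hasCompactSupport hp1 (hd i).continuous (hc i)
    exact (this.inner_const (𝕜 := ℝ) w).congr (Eventually.of_forall fun x => by
      simp [inner_smul_left]; ring)
  · intro i _
    have := hu.integrable_smul_of_hasCompactSupport hp1
      (ζ := fun x => fderiv ℝ (fun x => χ i x * ζ x) x w)
      (((hd i).continuous_fderiv (by simp)).clm_apply continuous_const)
      (((hc i).fderiv ℝ).comp_left (g := fun L : E n →L[ℝ] ℝ => L w) rfl)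
    exact this.congr (Eventually.of_forall fun x => by simp [mul_comm])

/-- Green's formula for functions with vanishing trace and smooth fields on `ℝⁿ`. -/
theorem DarcyForchheimer.HasTrace.hasZeroExtGrad {n : ℕ} (hn : 1 ≤ n) {Ω : Set (E n)}
    (hΩo : IsOpen Ω) (hΩb : Bornology.IsBounded Ω) (hΩ : HasC1Boundary Ω) {s : ℝ≥0∞}
    (hs : 1 ≤ s) {u : E n → ℝ} (h : HasTrace Ω s u 0) : HasZeroExtGrad Ω u (weakGrad Ω u) := by
  obtain ⟨m, rfl⟩ : ∃ m, n = m + 1 := ⟨n - 1, by omega⟩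
  obtain ⟨hW, -, Ψ, hΨ, hΨu, hΨg, hΨt⟩ := h
  have hfin : IsFiniteMeasure (vol Ω) := ⟨by simpa using hΩb.measure_lt_top⟩
  have hu : MemLp u s (vol Ω) := hW.1
  have hg := hW.memLp_weakGrad hΩo
  have hgrad := hW.isWeakGrad_weakGrad
  refine hasZeroExtGrad_of_locally hs hu hg fun x₀ => ?_
  by_cases h1 : x₀ ∈ Ω
  · exact ⟨Ω, hΩo, h1, fun ζ hζ hζc hζs w => hgrad.2.2 ζ ⟨hζ, hζc, hζs⟩ w⟩
  by_cases h2 : x₀ ∈ closure Ω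
  swap
  · refine ⟨(closure Ω)ᶜ, isClosed_closure.isOpen_compl, h2, fun ζ hζ hζc hζs w => ?_⟩
    have hz : ∀ x ∈ Ω, x ∉ tsupport ζ := fun x hx hxs => hζs hxs (subset_closure hx)
    rw [setIntegral_eq_zero_of_forall_eq_zero, setIntegral_eq_zero_of_forall_eq_zero, neg_zero]
    · intro x hx
      simp [image_eq_zero_of_notMem_tsupport (hz x hx)]
    · intro x hx
      rw [image_eq_zero_of_notMem_tsupport
        fun hcon => hz x hx (tsupport_fderiv_subset ℝ hcon)]
      simp
  obtain ⟨r, e, φ, hr, he, hφ, hΩr⟩ := hΩ x₀ ⟨h2, fun h => h1 (interior_subset h)⟩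
  obtain ⟨ν, hν, hνs, hbound⟩ := exists_finite_measure_le_surf hΩo he hφ hΩr
  refine ⟨Metric.ball x₀ r, Metric.isOpen_ball, Metric.mem_ball_self hr,
    fun ζ hζ hζc hζs w => ?_⟩
  obtain ⟨C, hC⟩ := hbound w
  obtain ⟨M₀, hM₀⟩ := hζ.continuous.bounded_above_of_compact_support hζc
  have hζw : Continuous fun x => fderiv ℝ ζ x w :=
    (hζ.continuous_fderiv (by simp)).clm_apply continuous_const
  have hζwc : HasCompactSupport fun x => fderiv ℝ ζ x w :=
    (hζc.fderiv ℝ).comp_left (g := fun L : E (m + 1) →L[ℝ] ℝ => L w) rfl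
  obtain ⟨M₁, hM₁⟩ := hζw.bounded_above_of_compact_support hζwc
  have i1 : ∀ j, Integrable (fun x => Ψ j x * fderiv ℝ ζ x w) (vol Ω) := fun j =>
    (((hΨ j).1.continuous.mul hζw).integrable_of_hasCompactSupport hζwc.mul_left).integrableOn
  have i2 : ∀ j, Integrable (fun x => inner ℝ (gradient (Ψ j) x) w * ζ x) (vol Ω) := fun j =>
    ((((continuous_gradient (hΨ j).1).inner continuous_const).mul
      hζ.continuous).integrable_of_hasCompactSupport hζc.mul_left).integrableOn
  have T1 : Tendsto (fun j => ∫ x in Ω, Ψ j x * fderiv ℝ ζ x w) atTop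
      (𝓝 (∫ x in Ω, u x * fderiv ℝ ζ x w)) := by
    refine tendsto_integral_of_tendsto_eLpNorm hs
      (fun j => (hΨ j).1.continuous.aestronglyMeasurable.sub hu.1) hΨu i1 ?_ M₁
      fun j => Eventually.of_forall fun x => ?_
    · exact (hu.integrable_smul_of_hasCompactSupport hs hζw hζwc).congr
        (Eventually.of_forall fun x => by simp [mul_comm])
    · rw [← sub_mul, norm_mul, mul_comm]
      exact mul_le_mul_of_nonneg_right (hM₁ x) (norm_nonneg _)
  have T2 : Tendsto (fun j => ∫ x in Ω, inner ℝ (gradient (Ψ j) x) w * ζ x) atTop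
      (𝓝 (∫ x in Ω, inner ℝ (weakGrad Ω u x) w * ζ x)) := by
    refine tendsto_integral_of_tendsto_eLpNorm hs
      (fun j => (continuous_gradient (hΨ j).1).aestronglyMeasurable.sub hg.1) hΨg i2 ?_ (M₀ * ‖w‖)
      fun j => Eventually.of_forall fun x => ?_
    · exact ((hg.integrable_smul_of_hasCompactSupport hs hζ.continuous hζc).inner_const
        (𝕜 := ℝ) w).congr (Eventually.of_forall fun x => by simp [inner_smul_left, mul_comm])
    · rw [← sub_mul, ← inner_sub_left, norm_mul, mul_comm, mul_assoc]
      refine mul_le_mul (hM₀ x) ?_ (norm_nonneg _) ((norm_nonneg _).trans (hM₀ x))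
      rw [mul_comm]
      exact norm_inner_le_norm _ _
  -- Vanishing trace gives convergence to zero in `L^s(ν)` since `ν ≤ surf Ω`, hence in `L¹(ν)`
  -- since `ν` is finite.
  have T3 : Tendsto (fun j => ∫ x, |Ψ j x * ζ x| ∂ν) atTop (𝓝 0) := by
    have hν0 : Tendsto (fun j => eLpNorm (Ψ j - 0) s ν) atTop (𝓝 0) :=
      tendsto_of_tendsto_of_tendsto_of_le_of_le tendsto_const_nhds hΨt (fun _ => zero_le)
        fun j => eLpNorm_mono_measure _ hνs
    have := tendsto_integral_of_tendsto_eLpNorm hs (μ := ν) (f₀ := (0 : E (m + 1) → ℝ))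
      (fun j => by simpa using (hΨ j).1.continuous.aestronglyMeasurable) hν0
      (a := fun j x => |Ψ j x * ζ x|) (a₀ := fun _ => 0) (fun j => ?_) (by simp) M₀
      (fun j => Eventually.of_forall fun x => ?_)
    · simpa using this
    · exact (((hΨ j).1.continuous.mul hζ.continuous).integrable_of_hasCompactSupport
        hζc.mul_left).abs
    · rw [sub_zero, Pi.zero_apply, sub_zero, Real.norm_eq_abs, abs_abs, abs_mul, mul_comm]
      exact mul_le_mul_of_nonneg_right (hM₀ x) (abs_nonneg _)
  -- The integral of a derivative of `Ψ j ζ` is a pure boundary term. Expanding it by the product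
  -- rule and using `T1`, `T2` yields the identity for `u`.
  have T4 : Tendsto (fun j => ∫ x in Ω, fderiv ℝ (fun y => Ψ j y * ζ y) x w) atTop (𝓝 0) := by
    refine squeeze_zero_norm (a := fun j => C * ∫ x, |Ψ j x * ζ x| ∂ν) (fun j => ?_)
      (by simpa only [mul_zero] using T3.const_mul C)
    exact hC _ (((hΨ j).1.mul hζ).of_le (by exact_mod_cast le_top)) hζc.mul_left
      (tsupport_mul_subset_right.trans hζs)
  have hsum : ∀ j, ∫ x in Ω, fderiv ℝ (fun y => Ψ j y * ζ y) x w
      = (∫ x in Ω, Ψ j x * fderiv ℝ ζ x w)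
        + ∫ x in Ω, inner ℝ (gradient (Ψ j) x) w * ζ x := fun j => by
    rw [← integral_add (i1 j) (i2 j)]
    refine integral_congr_ae (Eventually.of_forall fun x => ?_)
    simp only [fderiv_mul_smooth_apply (hΨ j).1 hζ, inner_gradient_left]
    ring
  simp_rw [hsum] at T4
  exact eq_neg_of_add_eq_zero_left (tendsto_nhds_unique (T1.add T2) T4)

/-! ### Test functions and the characterization of `W₀^{1,s}`. -/

theorem isWeakGrad_gradient {n : ℕ} {Ω : Set (E n)} {Ψ : E n → ℝ} (h : ContDiff ℝ ∞ Ψ) :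
    IsWeakGrad Ω Ψ (gradient Ψ) := by
  refine ⟨h.continuous.locallyIntegrable.locallyIntegrableOn _,
    (continuous_gradient h).locallyIntegrable.locallyIntegrableOn _, fun ψ hψ w => ?_⟩
  have e1 : ∫ x in Ω, Ψ x * fderiv ℝ ψ x w = ∫ x, Ψ x * fderiv ℝ ψ x w :=
    setIntegral_eq_integral_of_forall_compl_eq_zero fun x hx => by
      rw [image_eq_zero_of_notMem_tsupport
        fun hcon => hx (hψ.2.2 (tsupport_fderiv_subset ℝ hcon))]
      simp
  have e2 := setIntegral_smul_eq_integral_of_tsupport_subset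
    (f := fun x => inner ℝ (gradient Ψ x) w) hψ.2.2
  simp only [smul_eq_mul] at e2
  simp_rw [mul_comm _ (ψ _)]
  rw [e1, e2]
  simp_rw [inner_gradient_left]
  have hw : ∀ {f : E n → ℝ}, ContDiff ℝ ∞ f → Continuous fun x => fderiv ℝ f x w := fun hf =>
    (hf.continuous_fderiv (by simp)).clm_apply continuous_const
  rw [integral_mul_fderiv_eq_neg_fderiv_mul_of_integrable]
  · simp_rw [mul_comm]
  · exact ((hw h).mul hψ.1.continuous).integrable_of_hasCompactSupport hψ.2.1.mul_left
  · exact (h.continuous.mul (hw hψ.1)).integrable_of_hasCompactSupport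
      (HasCompactSupport.mul_left
        ((hψ.2.1.fderiv ℝ).comp_left (g := fun L : E n →L[ℝ] ℝ => L w) rfl))
  · exact (h.continuous.mul hψ.1.continuous).integrable_of_hasCompactSupport hψ.2.1.mul_left
  · exact fun x _ => (h.differentiable (by simp)) x
  · exact fun x _ => (hψ.1.differentiable (by simp)) x

theorem DarcyForchheimer.IsTest.eq_zero_on_frontier {n : ℕ} {Ω : Set (E n)} (hΩo : IsOpen Ω)
    {Ψ : E n → ℝ} (h : IsTest Ω Ψ) {x : E n} (hx : x ∈ frontier Ω) : Ψ x = 0 :=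
  image_eq_zero_of_notMem_tsupport fun hcon =>
    hx.2 (by rw [hΩo.interior_eq]; exact h.2.2 hcon)

theorem DarcyForchheimer.IsTest.eLpNorm_surf {n : ℕ} {Ω : Set (E n)} (hΩo : IsOpen Ω)
    {Ψ : E n → ℝ} (h : IsTest Ω Ψ) (s : ℝ≥0∞) : eLpNorm (Ψ - 0) s (surf Ω) = 0 := by
  have : Ψ - 0 =ᵐ[surf Ω] (0 : E n → ℝ) := by
    filter_upwards [ae_restrict_mem isClosed_frontier.measurableSet] with x hx
    simpa using h.eq_zero_on_frontier hΩo hx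
  rw [eLpNorm_congr_ae this, eLpNorm_zero]

theorem DarcyForchheimer.IsTest.memW1 {n : ℕ} {Ω : Set (E n)} {Ψ : E n → ℝ}
    (h : IsTest Ω Ψ) (s : ℝ≥0∞) : MemW1 Ω s Ψ :=
  ⟨(h.1.continuous.memLp_of_hasCompactSupport h.2.1).restrict _, gradient Ψ, isWeakGrad_gradient h.1,
    ((continuous_gradient h.1).memLp_of_hasCompactSupport
      (hasCompactSupport_gradient h.2.1)).restrict _⟩

theorem DarcyForchheimer.IsTest.weakGrad_ae_eq {n : ℕ} {Ω : Set (E n)} (hΩo : IsOpen Ω)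
    {Ψ : E n → ℝ} (h : IsTest Ω Ψ) : weakGrad Ω Ψ =ᵐ[vol Ω] gradient Ψ :=
  (weakGrad_spec (isWeakGrad_gradient h.1)).ae_eq hΩo (isWeakGrad_gradient h.1)

/-- The constant sequence `Ψ` approximates itself and vanishes on the frontier of the open set `Ω`.
-/
theorem DarcyForchheimer.IsTest.memW10 {n : ℕ} {Ω : Set (E n)} (hΩo : IsOpen Ω)
    {Ψ : E n → ℝ} (h : IsTest Ω Ψ) (s : ℝ≥0∞) : MemW10 Ω s Ψ := by
  refine ⟨h.memW1 s, MemLp.zero, fun _ => Ψ, fun _ => ⟨h.1, h.2.1⟩, ?_, ?_, ?_⟩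
  · simp
  · have : gradient Ψ - weakGrad Ω Ψ =ᵐ[vol Ω] 0 := by
      filter_upwards [h.weakGrad_ae_eq hΩo] with x hx
      simp [hx]
    simp [eLpNorm_congr_ae this]
  · simp only [h.eLpNorm_surf hΩo]
    exact tendsto_const_nhds

theorem HasZeroExtGrad.exists_seq_isTest {n : ℕ} {Ω : Set (E n)} (hΩo : IsOpen Ω)
    (hΩb : Bornology.IsBounded Ω) (hΩ : HasC1Boundary Ω) {s : ℝ≥0∞} (hs1 : 1 ≤ s) (hs : s ≠ ⊤)
    {u : E n → ℝ} {g : E n → E n} (hu : MemLp u s (vol Ω)) (hg : MemLp g s (vol Ω))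
    (h : HasZeroExtGrad Ω u g) :
    ∃ Ψ : ℕ → E n → ℝ, (∀ j, IsTest Ω (Ψ j)) ∧
      Tendsto (fun j => eLpNorm (Ψ j - u) s (vol Ω)) atTop (𝓝 0) ∧
      Tendsto (fun j => eLpNorm (gradient (Ψ j) - g) s (vol Ω)) atTop (𝓝 0) := by
  have hε : ∀ j : ℕ, ((j : ℝ≥0∞) + 1)⁻¹ ≠ 0 := fun j => ENNReal.inv_ne_zero.2 (by finiteness)
  have hlim : Tendsto (fun j : ℕ => ((j : ℝ≥0∞) + 1)⁻¹) atTop (𝓝 0) := by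
    have := (tendsto_add_atTop_iff_nat 1).2 ENNReal.tendsto_inv_nat_nhds_zero
    simpa using this
  choose Ψ hΨ hΨu hΨg using fun j => h.exists_isTest_near hΩo hΩb hΩ hs1 hs hu hg (hε j)
  exact ⟨Ψ, hΨ,
    tendsto_of_tendsto_of_tendsto_of_le_of_le tendsto_const_nhds hlim (fun _ => zero_le) hΨu,
    tendsto_of_tendsto_of_tendsto_of_le_of_le tendsto_const_nhds hlim (fun _ => zero_le) hΨg⟩

theorem MeasureTheory.MemLp.locallyIntegrableOn_of_restrict {n : ℕ} {V : Type*}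
    [NormedAddCommGroup V] {Ω : Set (E n)} {s : ℝ≥0∞} (hs : 1 ≤ s) {f : E n → V}
    (hf : MemLp f s (vol Ω)) : LocallyIntegrableOn f Ω volume :=
  locallyIntegrableOn_of_locallyIntegrable_restrict (hf.locallyIntegrable hs)

/-- A function whose extension by zero is weakly differentiable has vanishing trace. -/
theorem HasZeroExtGrad.memW10 {n : ℕ} {Ω : Set (E n)} (hΩo : IsOpen Ω)
    (hΩb : Bornology.IsBounded Ω) (hΩ : HasC1Boundary Ω) {s : ℝ≥0∞} (hs1 : 1 ≤ s) (hs : s ≠ ⊤)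
    {u : E n → ℝ} {g : E n → E n} (hu : MemLp u s (vol Ω)) (hg : MemLp g s (vol Ω))
    (h : HasZeroExtGrad Ω u g) :
    MemW10 Ω s u ∧ weakGrad Ω u =ᵐ[vol Ω] g := by
  have hgr : IsWeakGrad Ω u g := ⟨hu.locallyIntegrableOn_of_restrict hs1,
    hg.locallyIntegrableOn_of_restrict hs1, fun ψ hψ w => h ψ hψ.1 hψ.2.1 w⟩
  have hae : weakGrad Ω u =ᵐ[vol Ω] g := (weakGrad_spec hgr).ae_eq hΩo hgr
  obtain ⟨Ψ, hΨ, hΨu, hΨg⟩ := h.exists_seq_isTest hΩo hΩb hΩ hs1 hs hu hg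
  refine ⟨⟨⟨hu, g, hgr, hg⟩, MemLp.zero, Ψ, fun j => ⟨(hΨ j).1, (hΨ j).2.1⟩, hΨu, ?_, ?_⟩, hae⟩
  · refine hΨg.congr fun j => eLpNorm_congr_ae ?_
    exact (EventuallyEq.refl _ _).sub hae.symm
  · simp only [(hΨ _).eLpNorm_surf hΩo]
    exact tendsto_const_nhds

/-! ### The duality of `L³` and `L^{3/2}`, and Green's formula. -/

instance holderTriple_three_threeHalves : ENNReal.HolderTriple 3 (3 / 2) 1 := by
  refine ⟨?_⟩
  rw [ENNReal.inv_div (by simp) (by simp), inv_one, ← one_div, ENNReal.div_add_div_same,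
    show (1 : ℝ≥0∞) + 2 = 3 by norm_num, ENNReal.div_self (by simp) (by simp)]

theorem one_le_threeHalves : (1 : ℝ≥0∞) ≤ 3 / 2 := by
  rw [ENNReal.le_div_iff_mul_le (by simp) (by simp)]
  norm_num

theorem threeHalves_ne_top : (3 / 2 : ℝ≥0∞) ≠ ⊤ := by finiteness

section Holder

variable {α V : Type*} [MeasurableSpace α] {μ : Measure α} [NormedAddCommGroup V]
  [InnerProductSpace ℝ V] {p q : ℝ≥0∞}

theorem MeasureTheory.MemLp.integrable_inner_of_holder [hpq : ENNReal.HolderTriple p q 1]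
    {f g : α → V} (hf : MemLp f p μ) (hg : MemLp g q μ) :
    Integrable (fun x => inner ℝ (f x) (g x)) μ := by
  refine memLp_one_iff_integrable.1 (MemLp.of_bilin (fun a b => inner ℝ a b) 1 hf hg
    (hf.1.inner hg.1) (Eventually.of_forall fun x => ?_))
  simpa using nnnorm_inner_le_nnnorm (𝕜 := ℝ) (f x) (g x)

theorem tendsto_integral_inner_of_tendsto_eLpNorm [hpq : ENNReal.HolderTriple p q 1]
    {k : α → V} (hk : MemLp k p μ) {f : ℕ → α → V} {f₀ : α → V} (hf : ∀ j, MemLp (f j) q μ)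
    (hf₀ : MemLp f₀ q μ) (hlim : Tendsto (fun j => eLpNorm (f j - f₀) q μ) atTop (𝓝 0)) :
    Tendsto (fun j => ∫ x, inner ℝ (k x) (f j x) ∂μ) atTop (𝓝 (∫ x, inner ℝ (k x) (f₀ x) ∂μ)) := by
  refine tendsto_integral_of_L1' _ (hk.integrable_inner_of_holder hf₀).1
    (Eventually.of_forall fun j => hk.integrable_inner_of_holder (hf j)) ?_
  have hb : ∀ j, eLpNorm ((fun x => inner ℝ (k x) (f j x)) - fun x => inner ℝ (k x) (f₀ x)) 1 μ
      ≤ 1 * eLpNorm k p μ * eLpNorm (f j - f₀) q μ := fun j => by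
    have : ((fun x => inner ℝ (k x) (f j x)) - fun x => inner ℝ (k x) (f₀ x))
        = fun x => inner ℝ (k x) ((f j - f₀) x) := by
      ext x; simp [inner_sub_right]
    rw [this]
    refine eLpNorm_le_eLpNorm_mul_eLpNorm'_of_norm hk.1 ((hf j).1.sub hf₀.1)
      (fun a b => inner ℝ a b) 1 (Eventually.of_forall fun x => ?_)
    simpa using norm_inner_le_norm (𝕜 := ℝ) (k x) ((f j - f₀) x)
  refine tendsto_of_tendsto_of_tendsto_of_le_of_le tendsto_const_nhds ?_ (fun _ => zero_le) hb
  have := ENNReal.Tendsto.const_mul (a := 1 * eLpNorm k p μ) hlim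
    (Or.inr (by rw [one_mul]; exact hk.eLpNorm_ne_top))
  simpa using this

end Holder

/-- Green's formula for `v ∈ W³(div; Ω)` and `q ∈ W₀^{1,3/2}(Ω)`. -/
theorem integral_inner_weakGrad_eq_neg {n : ℕ} (hn : 1 ≤ n) {Ω : Set (E n)} (hΩo : IsOpen Ω)
    (hΩb : Bornology.IsBounded Ω) (hΩ : HasC1Boundary Ω) {v : E n → E n} (hv : MemWdiv Ω 3 v)
    {q : E n → ℝ} (hq : MemW10 Ω (3 / 2) q) :
    ∫ x in Ω, inner ℝ (v x) (weakGrad Ω q x) = - ∫ x in Ω, weakDiv Ω v x * q x := by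
  have hg := hq.1.memLp_weakGrad hΩo
  -- Against a test function the formula is the definition of weak divergence. Approximating `q`
  -- alone therefore suffices; no density of smooth fields and no normal trace of `v` enters.
  obtain ⟨Ψ, hΨ, hΨq, hΨg⟩ := (HasTrace.hasZeroExtGrad hn hΩo hΩb hΩ one_le_threeHalves
    hq).exists_seq_isTest hΩo hΩb hΩ one_le_threeHalves threeHalves_ne_top hq.1.1 hg
  have T1 := tendsto_integral_inner_of_tendsto_eLpNorm (μ := vol Ω) hv.1
    (fun j => (((continuous_gradient (hΨ j).1).memLp_of_hasCompactSupport
      (hasCompactSupport_gradient (hΨ j).2.1)).restrict _)) hg hΨg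
  have T2 := tendsto_integral_inner_of_tendsto_eLpNorm (μ := vol Ω) (hv.memLp_weakDiv hΩo)
    (fun j => ((hΨ j).1.continuous.memLp_of_hasCompactSupport (hΨ j).2.1).restrict _) hq.1.1 hΨq
  simp only [RCLike.inner_apply', conj_trivial] at T2
  refine tendsto_nhds_unique T1 (T2.neg.congr fun j => ?_)
  exact (hv.isWeakDiv_weakDiv.2.2 _ (hΨ j)).symm

/-! ### Inverting the Forchheimer law, and its growth. -/

section Coefficients

/-- The radicand is a perfect square: `a² + 4b(a + b|p|)|p| = (a + 2b|p|)²`. At `p = 0` the division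
by zero is harmless, as the scalar multiplies the zero vector. -/
theorem forchheimer_inv {V : Type*} [NormedAddCommGroup V] [NormedSpace ℝ V] {a b : ℝ}
    (ha : 0 < a) (hb : 0 < b) (p : V) :
    ((√(a ^ 2 + 4 * b * ‖(a + b * ‖p‖) • p‖) - a) / (2 * b * ‖(a + b * ‖p‖) • p‖)) •
      ((a + b * ‖p‖) • p) = p := by
  rcases eq_or_ne p 0 with rfl | hp
  · simp
  have hp' : 0 < ‖p‖ := norm_pos_iff.2 hp
  have hc : 0 < a + b * ‖p‖ := by positivity
  have hs : √(a ^ 2 + 4 * b * ‖(a + b * ‖p‖) • p‖) = a + 2 * b * ‖p‖ := by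
    rw [norm_smul, Real.norm_of_nonneg hc.le]
    rw [show a ^ 2 + 4 * b * ((a + b * ‖p‖) * ‖p‖) = (a + 2 * b * ‖p‖) ^ 2 by ring]
    exact Real.sqrt_sq (by positivity)
  rw [hs, norm_smul, Real.norm_of_nonneg hc.le, smul_smul]
  convert one_smul ℝ p
  field_simp
  ring

/-- `p` is parallel to `w`, and its length is the nonnegative root of `b t² + a t = |w|`. -/
theorem forchheimer_apply {V : Type*} [NormedAddCommGroup V] [NormedSpace ℝ V] {a b : ℝ}
    (ha : 0 < a) (hb : 0 < b) (w : V) :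
    ∃ p : V, ((√(a ^ 2 + 4 * b * ‖w‖) - a) / (2 * b * ‖w‖)) • w = p ∧ (a + b * ‖p‖) • p = w := by
  refine ⟨_, rfl, ?_⟩
  rcases eq_or_ne w 0 with rfl | hw
  · simp
  have hw' : 0 < ‖w‖ := norm_pos_iff.2 hw
  set s := √(a ^ 2 + 4 * b * ‖w‖) with hs
  have hs2 : s ^ 2 = a ^ 2 + 4 * b * ‖w‖ := Real.sq_sqrt (by positivity)
  have hsa : a ≤ s := Real.le_sqrt_of_sq_le (by nlinarith)
  have hc : 0 ≤ (s - a) / (2 * b * ‖w‖) := div_nonneg (by linarith) (by positivity)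
  rw [norm_smul, Real.norm_of_nonneg hc, smul_smul]
  convert one_smul ℝ w
  field_simp
  nlinarith

variable {n : ℕ} {Ω : Set (E n)}

theorem DarcyForchheimer.IsCoeff.ae_pos {a : E n → ℝ} (h : IsCoeff Ω a) :
    ∀ᵐ x ∂(vol Ω), 0 < a x := by
  obtain ⟨-, l, u, hl, h⟩ := h
  filter_upwards [h] with x hx using hl.trans_le hx.1

theorem DarcyForchheimer.IsCoeff.memLp_smul {a : E n → ℝ} (h : IsCoeff Ω a) {V : Type*}
    [NormedAddCommGroup V] [NormedSpace ℝ V] {f : E n → V} {p : ℝ≥0∞} (hf : MemLp f p (vol Ω)) :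
    MemLp (fun x => a x • f x) p (vol Ω) := by
  obtain ⟨ha, l, u, hl, h⟩ := h
  refine hf.of_le_mul (c := u) (ha.smul hf.1) ?_
  filter_upwards [h] with x hx
  rw [norm_smul, Real.norm_of_nonneg (hl.le.trans hx.1)]
  exact mul_le_mul_of_nonneg_right hx.2 (norm_nonneg _)

/-- Square-root growth turns `L^{3/2}` into `L³`. This serves both `F`, where `|F(w)|²` is at most a
constant times `|w|`, and `rho`, where `(S / √|S|)² = |S|`. -/
theorem MeasureTheory.MemLp.three_of_sq_le {α V W : Type*} [MeasurableSpace α] {μ : Measure α}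
    [NormedAddCommGroup V] [NormedAddCommGroup W] {f : α → V} {p : α → W}
    (hp : MemLp p (3 / 2) μ) (hf : AEStronglyMeasurable f μ) {C : ℝ}
    (h : ∀ᵐ x ∂μ, ‖f x‖ ^ 2 ≤ C * ‖p x‖) : MemLp f 3 μ := by
  have h1 := hp.norm_rpow_div 2⁻¹
  have h2 : (3 / 2 : ℝ≥0∞) / 2⁻¹ = 3 := by
    rw [div_eq_mul_inv, inv_inv]
    exact ENNReal.div_mul_cancel (by simp) (by simp)
  rw [h2] at h1
  refine h1.of_le_mul (c := √C) hf ?_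
  filter_upwards [h] with x hx
  have h3 : ‖p x‖ ^ (2⁻¹ : ℝ≥0∞).toReal = √‖p x‖ := by
    rw [Real.sqrt_eq_rpow]; simp
  rw [h3, Real.norm_of_nonneg (Real.sqrt_nonneg _), ← Real.sqrt_mul' _ (norm_nonneg _)]
  exact Real.le_sqrt_of_sq_le hx

theorem aestronglyMeasurable_F {α β : E n → ℝ} {w : E n → E n}
    (hα : AEStronglyMeasurable α (vol Ω)) (hβ : AEStronglyMeasurable β (vol Ω))
    (hw : AEStronglyMeasurable w (vol Ω)) : AEStronglyMeasurable (F α β w) (vol Ω) := by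
  have h1 := hα.aemeasurable
  have h2 := hβ.aemeasurable
  have h3 := hw.norm.aemeasurable
  have h4 : AEMeasurable
      (fun x => (√(α x ^ 2 + 4 * β x * ‖w x‖) - α x) / (2 * β x * ‖w x‖)) (vol Ω) := by
    fun_prop
  exact h4.aestronglyMeasurable.smul hw

theorem F_spec {α β : E n → ℝ} (hα : IsCoeff Ω α) (hβ : IsCoeff Ω β) (w : E n → E n) :
    ∀ᵐ x ∂(vol Ω), (α x + β x * ‖F α β w x‖) • F α β w x = w x := by
  filter_upwards [hα.ae_pos, hβ.ae_pos] with x ha hb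
  obtain ⟨p, hp, hpw⟩ := forchheimer_apply ha hb (w x)
  have : F α β w x = p := hp
  rw [this, hpw]

theorem F_neg_smul {α β : E n → ℝ} (hα : IsCoeff Ω α) (hβ : IsCoeff Ω β) (m : E n → E n) :
    F α β (fun x => -((α x + β x * ‖m x‖) • m x)) =ᵐ[vol Ω] -m := by
  filter_upwards [hα.ae_pos, hβ.ae_pos] with x ha hb
  have := forchheimer_inv ha hb (m x)
  simp only [F, norm_neg, smul_neg, Pi.neg_apply]
  rw [this]

theorem memLp_F {α β : E n → ℝ} (hα : IsCoeff Ω α) (hβ : IsCoeff Ω β) {w : E n → E n}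
    (hw : MemLp w (3 / 2) (vol Ω)) : MemLp (F α β w) 3 (vol Ω) := by
  obtain ⟨hβm, l, u, hl, hlu⟩ := hβ
  refine hw.three_of_sq_le (C := l⁻¹) (aestronglyMeasurable_F hα.1 hβm hw.1) ?_
  filter_upwards [hα.ae_pos, hlu, F_spec hα ⟨hβm, l, u, hl, hlu⟩ w] with x ha hb hx
  set p := F α β w x
  have hc : 0 ≤ α x + β x * ‖p‖ :=
    add_nonneg ha.le (mul_nonneg (hl.le.trans hb.1) (norm_nonneg _))
  -- Dropping the `α` term from `(α + β|p|)|p| = |w|` and using `β ≥ l` leaves `l|p|² ≤ |w|`.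
  rw [← hx, norm_smul, Real.norm_of_nonneg hc, ← div_eq_inv_mul, le_div_iff₀ hl]
  nlinarith [norm_nonneg p, mul_nonneg ha.le (norm_nonneg p),
    mul_le_mul_of_nonneg_right hb.1 (sq_nonneg ‖p‖)]

theorem memLp_rho {γ S : E n → ℝ} (hγ : IsCoeff Ω γ) (hS : MemLp S (3 / 2) (vol Ω)) :
    MemLp (rho γ S) 3 (vol Ω) := by
  refine hγ.memLp_smul (f := fun x => S x / √|S x|) (hS.three_of_sq_le (C := 1) ?_ ?_)
  · have := hS.1.aemeasurable
    exact AEMeasurable.aestronglyMeasurable (by fun_prop)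
  · refine Eventually.of_forall fun x => ?_
    rw [one_mul, Real.norm_eq_abs, sq_abs, div_pow, Real.sq_sqrt (abs_nonneg _), ← sq_abs,
      Real.norm_eq_abs, sq, mul_self_div_self]

/-- The quadratic term lies in `L^{3/2}` because `|m|` is in `L³`; the linear term does because `Ω`
has finite measure. -/
theorem memLp_forchheimer {α β : E n → ℝ} (hα : IsCoeff Ω α) (hβ : IsCoeff Ω β)
    [IsFiniteMeasure (vol Ω)] {m : E n → E n} (hm : MemLp m 3 (vol Ω)) :
    MemLp (fun x => (α x + β x * ‖m x‖) • m x) (3 / 2) (vol Ω) := by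
  have h32 : (3 / 2 : ℝ≥0∞) ≤ 3 := ENNReal.div_le_of_le_mul (by norm_num)
  have h1 : MemLp (fun x => ‖m x‖ • m x) (3 / 2) (vol Ω) := by
    have h2 := hm.norm_rpow_div 2
    refine h2.of_le (hm.1.norm.smul hm.1) (Eventually.of_forall fun x => ?_)
    simp [norm_smul, sq]
  have := (hα.memLp_smul (hm.mono_exponent h32)).add (hβ.memLp_smul h1)
  refine (memLp_congr_ae (Eventually.of_forall fun x => ?_)).1 this
  simp [add_smul, mul_smul]

end Coefficients

/-! ### Smooth fields as test fields, and the equivalence for one time step. -/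

theorem isWeakDiv_smul_const {n : ℕ} {Ω : Set (E n)} {ζ : E n → ℝ} (hζ : ContDiff ℝ ∞ ζ)
    (w : E n) : IsWeakDiv Ω (fun x => ζ x • w) (fun x => fderiv ℝ ζ x w) := by
  have hw : Continuous fun x => fderiv ℝ ζ x w :=
    (hζ.continuous_fderiv (by simp)).clm_apply continuous_const
  refine ⟨(hζ.continuous.smul continuous_const).locallyIntegrable.locallyIntegrableOn _,
    hw.locallyIntegrable.locallyIntegrableOn _, fun ψ hψ => ?_⟩
  have := (isWeakGrad_gradient (Ω := Ω) hζ).2.2 ψ hψ w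
  simp_rw [inner_gradient_left] at this
  rw [← this]
  refine integral_congr_ae (Eventually.of_forall fun x => ?_)
  simp only [inner_smul_left, conj_trivial]
  rw [real_inner_comm, inner_gradient_left]

/-- Since `ζ` may be nonzero on the frontier, testing the flux equation with these fields detects
the boundary values of `S`. -/
theorem memWdiv_smul_const {n : ℕ} {Ω : Set (E n)} {ζ : E n → ℝ} (hζ : ContDiff ℝ ∞ ζ)
    (hζc : HasCompactSupport ζ) (w : E n) (s : ℝ≥0∞) : MemWdiv Ω s (fun x => ζ x • w) :=
  ⟨((hζ.continuous.smul continuous_const).memLp_of_hasCompactSupport hζc.smul_right).restrict _,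
    _, isWeakDiv_smul_const hζ w,
    (((hζ.continuous_fderiv (by simp)).clm_apply continuous_const).memLp_of_hasCompactSupport
      ((hζc.fderiv ℝ).comp_left (g := fun L : E n →L[ℝ] ℝ => L w) rfl)).restrict _⟩

theorem DarcyForchheimer.IsWeakDiv.neg {n : ℕ} {Ω : Set (E n)} {v : E n → E n} {d : E n → ℝ}
    (h : IsWeakDiv Ω v d) : IsWeakDiv Ω (-v) (-d) := by
  refine ⟨h.1.neg, h.2.1.neg, fun ψ hψ => ?_⟩
  simp only [Pi.neg_apply, inner_neg_left, neg_mul, integral_neg]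
  rw [h.2.2 ψ hψ]

section TimeStep

variable {n : ℕ} {Ω : Set (E n)} {Δt : ℝ} {φ α β γ γ' f S' : E n → ℝ}

theorem memLp_accumulation (hφ : IsCoeff Ω φ) (hγ : IsCoeff Ω γ) (hγ' : IsCoeff Ω γ')
    (hS' : MemLp S' (3 / 2) (vol Ω)) {S : E n → ℝ} (hS : MemLp S (3 / 2) (vol Ω)) :
    MemLp (fun x => φ x / Δt * (rho γ S x - rho γ' S' x)) 3 (vol Ω) := by
  have := (hφ.memLp_smul ((memLp_rho hγ hS).sub (memLp_rho hγ' hS'))).const_mul Δt⁻¹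
  refine (memLp_congr_ae (Eventually.of_forall fun x => ?_)).1 this
  simp only [Pi.sub_apply, smul_eq_mul]
  ring

theorem MeasureTheory.MemLp.integrable_mul_of_holder {a q : E n → ℝ} (ha : MemLp a 3 (vol Ω))
    (hq : MemLp q (3 / 2) (vol Ω)) : Integrable (fun x => a x * q x) (vol Ω) :=
  ha.integrable_mul hq

theorem DarcyForchheimer.IsPrimalSolution.isMixedSolution (hn : 1 ≤ n) (hΩo : IsOpen Ω)
    (hΩb : Bornology.IsBounded Ω) (hΩ : HasC1Boundary Ω) (hφ : IsCoeff Ω φ) (hα : IsCoeff Ω α)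
    (hβ : IsCoeff Ω β) (hγ : IsCoeff Ω γ) (hγ' : IsCoeff Ω γ') (hf : MemLp f 3 (vol Ω))
    (hS' : MemLp S' (3 / 2) (vol Ω)) {S : E n → ℝ}
    (h : IsPrimalSolution Ω Δt φ α β γ γ' f S' S) :
    MemWdiv Ω 3 (F α β (weakGrad Ω S)) ∧
      IsMixedSolution Ω Δt φ α β γ γ' f S' (-F α β (weakGrad Ω S)) S := by
  obtain ⟨hS, heq⟩ := h
  have h3 : (1 : ℝ≥0∞) ≤ 3 := by norm_num
  set A : E n → ℝ := fun x => φ x / Δt * (rho γ S x - rho γ' S' x)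
  have hA : MemLp A 3 (vol Ω) := memLp_accumulation hφ hγ hγ' hS' hS.1.1
  have hF : MemLp (F α β (weakGrad Ω S)) 3 (vol Ω) := memLp_F hα hβ (hS.1.memLp_weakGrad hΩo)
  have hd : MemLp (A - f) 3 (vol Ω) := hA.sub hf
  -- Test functions are admissible in the primal equation, which then reads `div F(∇S) = A - f` in
  -- distributions. As `A - f` is in `L³`, the mass equation extends to all `q` in `L^{3/2}`.
  have hdiv : IsWeakDiv Ω (F α β (weakGrad Ω S)) (A - f) := by
    refine ⟨hF.locallyIntegrableOn_of_restrict h3, hd.locallyIntegrableOn_of_restrict h3,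
      fun ψ hψ => ?_⟩
    have e1 := heq ψ (hψ.memW10 hΩo _)
    have e2 : ∫ x in Ω, inner ℝ (F α β (weakGrad Ω S) x) (weakGrad Ω ψ x)
        = ∫ x in Ω, inner ℝ (F α β (weakGrad Ω S) x) (gradient ψ x) := by
      refine integral_congr_ae ?_
      filter_upwards [hψ.weakGrad_ae_eq hΩo] with x hx
      rw [hx]
    have hψp : MemLp ψ (3 / 2) (vol Ω) := (hψ.memW1 _).1
    have e3 : ∫ x in Ω, (A - f) x * ψ x = (∫ x in Ω, A x * ψ x) - ∫ x in Ω, f x * ψ x := by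
      rw [← integral_sub (hA.integrable_mul_of_holder hψp) (hf.integrable_mul_of_holder hψp)]
      simp [sub_mul]
    rw [e2] at e1
    rw [e3]
    linarith
  have hdivneg : weakDiv Ω (-F α β (weakGrad Ω S)) =ᵐ[vol Ω] -(A - f) :=
    (weakDiv_spec hdiv.neg).ae_eq hΩo hdiv.neg
  refine ⟨⟨hF, _, hdiv, hd⟩, ⟨hF.neg, _, hdiv.neg, hd.neg⟩, hS.1.1, fun v hv => ?_, fun q hq => ?_⟩
  · have e1 := integral_inner_weakGrad_eq_neg hn hΩo hΩb hΩ hv hS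
    have e2 : ∫ x in Ω, (α x + β x * ‖(-F α β (weakGrad Ω S)) x‖) *
        inner ℝ ((-F α β (weakGrad Ω S)) x) (v x)
        = ∫ x in Ω, -inner ℝ (v x) (weakGrad Ω S x) := by
      refine integral_congr_ae ?_
      filter_upwards [F_spec hα hβ (weakGrad Ω S)] with x hx
      rw [← congrArg (inner ℝ (v x)) hx, Pi.neg_apply, norm_neg, inner_neg_left, inner_smul_right, real_inner_comm]
      ring
    rw [e2, integral_neg, e1, neg_neg, sub_self]
  · have e1 : ∫ x in Ω, weakDiv Ω (-F α β (weakGrad Ω S)) x * q x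
        = (∫ x in Ω, f x * q x) - ∫ x in Ω, A x * q x := by
      rw [← integral_sub (hf.integrable_mul_of_holder hq) (hA.integrable_mul_of_holder hq)]
      refine integral_congr_ae ?_
      filter_upwards [hdivneg] with x hx
      rw [hx]
      simp [sub_mul]
    rw [e1]
    ring

theorem DarcyForchheimer.IsMixedSolution.isPrimalSolution (hn : 1 ≤ n) (hΩo : IsOpen Ω)
    (hΩb : Bornology.IsBounded Ω) (hΩ : HasC1Boundary Ω) (hα : IsCoeff Ω α)
    (hβ : IsCoeff Ω β) {m : E n → E n} {S : E n → ℝ}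
    (h : IsMixedSolution Ω Δt φ α β γ γ' f S' m S) :
    IsPrimalSolution Ω Δt φ α β γ γ' f S' S ∧ m =ᵐ[vol Ω] -F α β (weakGrad Ω S) := by
  obtain ⟨hm, hS, hflux, hmass⟩ := h
  have hfin : IsFiniteMeasure (vol Ω) := ⟨by simpa using hΩb.measure_lt_top⟩
  have hg : MemLp (fun x => -((α x + β x * ‖m x‖) • m x)) (3 / 2) (vol Ω) :=
    (memLp_forchheimer hα hβ hm.1).neg
  -- This is the flux equation with `v = ζ w`, whose divergence is the derivative of `ζ` along `w`.
  have hzero : HasZeroExtGrad Ω S fun x => -((α x + β x * ‖m x‖) • m x) := by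
    intro ζ hζ hζc w
    have e1 := hflux _ (memWdiv_smul_const hζ hζc w 3)
    have e2 : ∫ x in Ω, weakDiv Ω (fun x => ζ x • w) x * S x
        = ∫ x in Ω, S x * fderiv ℝ ζ x w := by
      refine integral_congr_ae ?_
      filter_upwards [(weakDiv_spec (isWeakDiv_smul_const hζ w)).ae_eq hΩo
        (isWeakDiv_smul_const hζ w)] with x hx
      rw [hx, mul_comm]
    rw [e2, sub_eq_zero] at e1
    rw [← e1, ← integral_neg]
    refine integral_congr_ae (Eventually.of_forall fun x => ?_)
    simp only [inner_smul_right, inner_neg_left, inner_smul_left, conj_trivial]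
    ring
  -- Both the vanishing trace and `∇S = -(α + β|m|) m` come from the zero extension; applying `F` to
  -- the latter recovers `-m`.
  obtain ⟨hS0, hgrad⟩ := hzero.memW10 hΩo hΩb hΩ one_le_threeHalves threeHalves_ne_top hS hg
  have hmF : m =ᵐ[vol Ω] -F α β (weakGrad Ω S) := by
    filter_upwards [F_neg_smul hα hβ m, hgrad] with x hx hgx
    have : F α β (weakGrad Ω S) x = -m x := by
      rw [← Pi.neg_apply, ← hx]
      simp only [F, hgx]
    rw [Pi.neg_apply, this, neg_neg]
  refine ⟨⟨hS0, fun q hq => ?_⟩, hmF⟩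
  have e1 := integral_inner_weakGrad_eq_neg hn hΩo hΩb hΩ hm hq
  have e2 : ∫ x in Ω, inner ℝ (F α β (weakGrad Ω S) x) (weakGrad Ω q x)
      = - ∫ x in Ω, inner ℝ (m x) (weakGrad Ω q x) := by
    rw [← integral_neg]
    refine integral_congr_ae ?_
    filter_upwards [hmF] with x hx
    rw [hx, Pi.neg_apply, inner_neg_left, neg_neg]
  rw [e2, e1, neg_neg]
  exact hmass q hq.1.1

end TimeStep

theorem mainTheorem5 (n : ℕ) (hn : 1 ≤ n) (Ω : Set (E n)) (hΩo : IsOpen Ω)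
    (hΩb : Bornology.IsBounded Ω) (hΩ : HasC1Boundary Ω)
    (T : ℝ) (hT : 0 < T) (K : ℕ)
    (φ : E n → ℝ) (α β γ f : ℕ → E n → ℝ)
    (hφ : IsCoeff Ω φ)
    (hα : ∀ k, 1 ≤ k → k ≤ K → IsCoeff Ω (α k))
    (hβ : ∀ k, 1 ≤ k → k ≤ K → IsCoeff Ω (β k))
    (hγ : ∀ k, k ≤ K → IsCoeff Ω (γ k))
    (hf : ∀ k, 1 ≤ k → k ≤ K → MemLp (f k) 3 (vol Ω))
    (k : ℕ) (hk : 1 ≤ k) (hkK : k ≤ K)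
    (S' : E n → ℝ) (hS' : MemLp S' (3 / 2) (vol Ω)) :
    (∀ S : E n → ℝ,
      IsPrimalSolution Ω (T / K) φ (α k) (β k) (γ k) (γ (k - 1)) (f k) S' S →
        MemWdiv Ω 3 (F (α k) (β k) (weakGrad Ω S)) ∧
        IsMixedSolution Ω (T / K) φ (α k) (β k) (γ k) (γ (k - 1)) (f k) S'
          (-F (α k) (β k) (weakGrad Ω S)) S) ∧
    (∀ (m : E n → E n) (S : E n → ℝ),
      IsMixedSolution Ω (T / K) φ (α k) (β k) (γ k) (γ (k - 1)) (f k) S' m S →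
        IsPrimalSolution Ω (T / K) φ (α k) (β k) (γ k) (γ (k - 1)) (f k) S' S ∧
        HasTrace Ω (3 / 2) S 0 ∧
        m =ᵐ[vol Ω] -F (α k) (β k) (weakGrad Ω S)) := by
  have hγ' := hγ (k - 1) (by omega)
  refine ⟨fun S h => h.isMixedSolution hn hΩo hΩb hΩ hφ (hα k hk hkK) (hβ k hk hkK) (hγ k hkK)
    hγ' (hf k hk hkK) hS', fun m S h => ?_⟩
  have h' := h.isPrimalSolution hn hΩo hΩb hΩ (hα k hk hkK) (hβ k hk hkK)
  exact ⟨h'.1, h'.1.1, h'.2⟩
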